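/- Let $(M^2,g)$ be a connected oriented smooth Riemannian surface with Levi-Civita connection $\nabla$, and let $T$ be a smooth symmetric tensor field of type $(1,1)$ on $M$, that is, a smooth field of endomorphisms of the tangent spaces with $\langle T(X),Y\rangle=\langle X,T(Y)\rangle$. Put $t=\operatorname{trace}T$ and $\operatorname{div}T=\sum_{i}(\nabla_{X_i}T)(X_i)$ for a local orthonormal frame field $\{X_1,X_2\}$. Call $T$ a Codazzi tensor field if $(\nabla_XT)(Y)=(\nabla_YT)(X)$ for all smooth vector fields $X,Y$ on $M$. Say that $\langle T(\partial_z),\partial_z\rangle$ is holomorphic if, in every positively oriented isothermal chart $(x,y)$ (one in which $g=e^{2\rho}(dx^2+dy^2)$ with $\rho$ smooth), it is a holomorphic function of $z=x+iy$, where $\partial_z=\frac12(\partial_x-i\,\partial_y)$ and $T$ and $\langle\cdot,\cdot\rangle$ are extended complex (bi)linearly. Then any two of the following conditions imply each of the others: 1. $\operatorname{div}T=0$ on $M$; 2. $t$ is constant on $M$; 3. $\langle T(\partial_z),\partial_z\rangle$ is holomorphic; 4. $T$ is a Codazzi tensor field. -/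

import Mathlib

open scoped Manifold ContDiff Bundle TensorProduct

noncomputable section

namespace RiemSurf

/-- The model space of surfaces, `ℝ²` with its Euclidean structure. -/
abbrev Plane : Type := EuclideanSpace ℝ (Fin 2)

section Orientation

variable (M : Type*) [TopologicalSpace M] [ChartedSpace Plane M]

/-- An orientation of the surface `M`, given by an oriented atlas: a family of smooth charts that
cover `M` and whose transition maps have positive Jacobian determinant. -/
structure OrientedAtlas where
  /-- the charts of the oriented atlas -/
  charts : Set (OpenPartialHomeomorph M Plane)
  smooth : charts ⊆ IsManifold.maximalAtlas (𝓡 2) ∞ M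
  cover : ∀ p : M, ∃ φ ∈ charts, p ∈ φ.source
  jacobian_pos : ∀ φ ∈ charts, ∀ ψ ∈ charts, ∀ y ∈ (φ.symm.trans ψ).source,
    0 < (fderiv ℝ (φ.symm.trans ψ) y).det

variable {M}

/-- The chart `φ` is positively oriented: its transition maps to all charts of the given oriented
atlas have positive Jacobian determinant. -/
def OrientedAtlas.IsPositive (𝒪 : OrientedAtlas M) (φ : OpenPartialHomeomorph M Plane) : Prop :=
  ∀ ψ ∈ 𝒪.charts, ∀ y ∈ (φ.symm.trans ψ).source, 0 < (fderiv ℝ (φ.symm.trans ψ) y).det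

end Orientation

section Riemannian

variable {M : Type*} [TopologicalSpace M] [ChartedSpace Plane M] [IsManifold (𝓡 2) ∞ M]

instance finiteDimensional_tangentSpace (x : M) :
    FiniteDimensional ℝ (TangentSpace (𝓡 2) x) :=
  inferInstanceAs (FiniteDimensional ℝ Plane)

/-- A vector field on `M` is smooth, that is, it is an element of `C(TM)`. -/
def IsSmoothField (X : Π x : M, TangentSpace (𝓡 2) x) : Prop :=
  ContMDiff (𝓡 2) (𝓡 2).tangent ∞ (fun x => (⟨x, X x⟩ : TangentBundle (𝓡 2) M))

/-- A local extension of the tangent vector `v` at `x` to a vector field, smooth near `x`. -/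
def extendVec {x : M} (v : TangentSpace (𝓡 2) x) : Π y : M, TangentSpace (𝓡 2) y :=
  FiberBundle.extend Plane v

/-- A field of endomorphisms of the tangent spaces is smooth, that is, it is a tensor field of
type `(1,1)`. -/
def IsSmoothTensor (T : Π x : M, TangentSpace (𝓡 2) x →L[ℝ] TangentSpace (𝓡 2) x) : Prop :=
  ContMDiff (𝓡 2) ((𝓡 2).prod 𝓘(ℝ, Plane →L[ℝ] Plane)) ∞
    (fun x => Bundle.TotalSpace.mk' (Plane →L[ℝ] Plane)
      (E := fun x : M => TangentSpace (𝓡 2) x →L[ℝ] TangentSpace (𝓡 2) x) x (T x))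

/-- The trace `t` of a tensor field of type `(1,1)`. -/
def tensorTrace (T : Π x : M, TangentSpace (𝓡 2) x →L[ℝ] TangentSpace (𝓡 2) x) (x : M) : ℝ :=
  LinearMap.trace ℝ (TangentSpace (𝓡 2) x) (T x).toLinearMap

/-- The trace of `T` is constant on `M`. -/
def HasConstantTrace (T : Π x : M, TangentSpace (𝓡 2) x →L[ℝ] TangentSpace (𝓡 2) x) : Prop :=
  ∃ c : ℝ, ∀ x : M, tensorTrace T x = c

variable [Bundle.RiemannianBundle (fun x : M => TangentSpace (𝓡 2) x)]

/-- The tensor field `T` is symmetric: `⟨T X, Y⟩ = ⟨X, T Y⟩`. -/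
def IsSymmetricTensor
    (T : Π x : M, TangentSpace (𝓡 2) x →L[ℝ] TangentSpace (𝓡 2) x) : Prop :=
  ∀ (x : M) (v w : TangentSpace (𝓡 2) x), inner ℝ (T x v) w = inner ℝ v (T x w)

/-- The derivative `X⟨Y, Z⟩` at `x`. -/
def derivInner (X Y Z : Π x : M, TangentSpace (𝓡 2) x) (x : M) : ℝ :=
  mvfderiv (𝓡 2) (fun y : M => (inner ℝ (Y y) (Z y) : ℝ)) x (X x)

/-- The right-hand side of the Koszul formula for `2⟨∇_X Y, Z⟩`. -/
def koszul (X Y Z : Π x : M, TangentSpace (𝓡 2) x) (x : M) : ℝ :=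
  derivInner X Y Z x + derivInner Y Z X x - derivInner Z X Y x
    + inner ℝ (VectorField.mlieBracket (𝓡 2) X Y x) (Z x)
    - inner ℝ (VectorField.mlieBracket (𝓡 2) X Z x) (Y x)
    - inner ℝ (VectorField.mlieBracket (𝓡 2) Y Z x) (X x)

/-- The Levi-Civita connection `∇_X Y` of the Riemannian metric: the vector field with
`2⟨∇_X Y, Z⟩ = koszul X Y Z` for all `Z`, written out in an orthonormal basis of `T_x M`. -/
def leviCivita (X Y : Π x : M, TangentSpace (𝓡 2) x) (x : M) : TangentSpace (𝓡 2) x :=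
  ∑ i, (koszul X Y (extendVec (stdOrthonormalBasis ℝ (TangentSpace (𝓡 2) x) i)) x / 2) •
    stdOrthonormalBasis ℝ (TangentSpace (𝓡 2) x) i

/-- The covariant derivative of the tensor field `T`: `(∇_X T)(Y) = ∇_X (T Y) - T (∇_X Y)`. -/
def nablaTensor (T : Π x : M, TangentSpace (𝓡 2) x →L[ℝ] TangentSpace (𝓡 2) x)
    (X Y : Π x : M, TangentSpace (𝓡 2) x) (x : M) : TangentSpace (𝓡 2) x :=
  leviCivita X (fun y => T y (Y y)) x - T x (leviCivita X Y x)

/-- The divergence `div T = ∑ᵢ (∇_{Xᵢ} T)(Xᵢ)`, where the vectors `Xᵢ` are an orthonormal basis of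
the tangent space at the point, extended to local vector fields. -/
def divTensor (T : Π x : M, TangentSpace (𝓡 2) x →L[ℝ] TangentSpace (𝓡 2) x) (x : M) :
    TangentSpace (𝓡 2) x :=
  ∑ i, nablaTensor T (extendVec (stdOrthonormalBasis ℝ (TangentSpace (𝓡 2) x) i))
    (extendVec (stdOrthonormalBasis ℝ (TangentSpace (𝓡 2) x) i)) x

/-- `div T = 0` on `M`. -/
def IsDivFree (T : Π x : M, TangentSpace (𝓡 2) x →L[ℝ] TangentSpace (𝓡 2) x) : Prop :=
  ∀ x : M, divTensor T x = 0

/-- `T` is a Codazzi tensor field: `(∇_X T)(Y) = (∇_Y T)(X)` for all `X, Y ∈ C(TM)`. -/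
def IsCodazzi (T : Π x : M, TangentSpace (𝓡 2) x →L[ℝ] TangentSpace (𝓡 2) x) : Prop :=
  ∀ X Y : Π x : M, TangentSpace (𝓡 2) x, IsSmoothField X → IsSmoothField Y →
    ∀ x : M, nablaTensor T X Y x = nablaTensor T Y X x

/-- The coordinate vector `∂_x` (for `i = 0`) or `∂_y` (for `i = 1`) of the chart `φ`, at the point
with coordinates `y`. -/
def coordVec (φ : OpenPartialHomeomorph M Plane) (i : Fin 2) (y : Plane) :
    TangentSpace (𝓡 2) (φ.symm y) :=
  mfderiv (𝓡 2) (𝓡 2) φ.symm y (EuclideanSpace.single i (1 : ℝ) : Plane)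

/-- `φ` is a smooth isothermal chart: in its coordinates `g = e^{2ρ} (dx² + dy²)`. -/
def IsIsothermal (φ : OpenPartialHomeomorph M Plane) : Prop :=
  φ ∈ IsManifold.maximalAtlas (𝓡 2) ∞ M ∧
    ∃ ρ : Plane → ℝ, ContDiffOn ℝ ∞ ρ φ.target ∧ ∀ y ∈ φ.target, ∀ i j : Fin 2,
      inner ℝ (coordVec φ i y) (coordVec φ j y) = if i = j then Real.exp (2 * ρ y) else 0

/-- The complex tangent vector `∂_z = (∂_x - i ∂_y) / 2` of the chart `φ`. -/
def dz (φ : OpenPartialHomeomorph M Plane) (y : Plane) :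
    ℂ ⊗[ℝ] TangentSpace (𝓡 2) (φ.symm y) :=
  (1 / 2 : ℂ) • ((1 : ℂ) ⊗ₜ[ℝ] coordVec φ 0 y - Complex.I ⊗ₜ[ℝ] coordVec φ 1 y)

/-- The complex bilinear extension of the metric to the complexified tangent space. -/
def complexMetric (x : M) : LinearMap.BilinForm ℂ (ℂ ⊗[ℝ] TangentSpace (𝓡 2) x) :=
  LinearMap.BilinForm.baseChange ℂ (innerₗ (TangentSpace (𝓡 2) x))

/-- The function `⟨T(∂_z), ∂_z⟩` in the chart `φ`, as a function of the coordinates; `T` and the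
metric are extended complex linearly. -/
def hopf (T : Π x : M, TangentSpace (𝓡 2) x →L[ℝ] TangentSpace (𝓡 2) x)
    (φ : OpenPartialHomeomorph M Plane) (y : Plane) : ℂ :=
  complexMetric (φ.symm y) ((T (φ.symm y)).toLinearMap.baseChange ℂ (dz φ y)) (dz φ y)

/-- The identification of `z = x + i y` with `(x, y)`. -/
def toPlane (z : ℂ) : Plane := !₂[z.re, z.im]

/-- `⟨T(∂_z), ∂_z⟩` is holomorphic: in every positively oriented isothermal chart it is a
holomorphic function of the complex coordinate `z = x + i y`. -/
def IsHolomorphicHopf (𝒪 : OrientedAtlas M)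
    (T : Π x : M, TangentSpace (𝓡 2) x →L[ℝ] TangentSpace (𝓡 2) x) : Prop :=
  ∀ φ : OpenPartialHomeomorph M Plane, IsIsothermal φ → 𝒪.IsPositive φ →
    DifferentiableOn ℂ (fun z => hopf T φ (toPlane z)) (toPlane ⁻¹' φ.target)

end Riemannian

end RiemSurf

end

/-! Everything rests on two vector fields, `div T` and `∇t`. On a surface `T` is Codazzi exactly
when `div T = ∇t`: the defect of the Codazzi equation is alternating in its two arguments, so in
dimension two it amounts to a single vector. The Hopf function sees only the traceless part `T -
(t/2) I`, and the Cauchy-Riemann equations for it say that this part is divergence free, that is `2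
div T = ∇t`. The four conditions are thus the vanishing of `div T`, `∇t`, `div T - ∇t` and `2 div T
- ∇t`. Any two of these combinations are linearly independent, so the vanishing of two forces that
of all four.

The computation is carried out in a chart where `g = e^{2ρ} (dx² + dy²)`. There the connection, and
hence `∇T`, has an explicit form, and each condition becomes a pair of linear first-order equations
for the symmetric matrix of `T`: `DivEq`, `TraceEq`, `CodazziEq`, `HopfEq`. Passing from `∇t = 0` to
constancy of `t` uses connectedness.

Holomorphy is a statement about positively oriented isothermal charts only, so it has content at a
point only if such a chart exists there. This is `exists_isothermal_chart`, the bulk of the work. A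
local diffeomorphism `f` is conformal for `g` when it solves the Beltrami equation `f_z̄ = μ f_z`,
with `|μ| < 1` determined by `g`. After zooming in at a point and cutting off, `μ` becomes a
constant plus a periodic function whose Fourier coefficients have small `ℓ¹` norm. The equation is
then solved by a Neumann series for convolution in weighted `ℓ¹` spaces
(`exists_beltrami_periodic`). The weights give smoothness, and smallness gives `f_z ≠ 0`, so the
inverse function theorem applies. -/

set_option linter.unusedSectionVars false

/-! ### Vector fields and Lie brackets in a chart. -/

noncomputable section

namespace RiemSurf

open Set Filter Topology

section Chart

variable {M : Type*} [TopologicalSpace M] [ChartedSpace Plane M] [IsManifold (𝓡 2) ∞ M]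
  {φ : OpenPartialHomeomorph M Plane}

/-- The coordinate expression of a vector field in the chart `φ`. -/
def localRep (φ : OpenPartialHomeomorph M Plane) (X : Π x : M, TangentSpace (𝓡 2) x)
    (y : Plane) : Plane :=
  VectorField.mpullback (𝓡 2) (𝓡 2) φ.symm X y

lemma contMDiffAt_chart_symm (hφ : φ ∈ IsManifold.maximalAtlas (𝓡 2) ∞ M) {y : Plane}
    (hy : y ∈ φ.target) : ContMDiffAt (𝓡 2) (𝓡 2) ∞ φ.symm y :=
  contMDiffAt_symm_of_mem_maximalAtlas hφ hy

lemma chart_mdifferentiable (hφ : φ ∈ IsManifold.maximalAtlas (𝓡 2) ∞ M) :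
    φ.MDifferentiable (𝓡 2) (𝓡 2) :=
  ⟨(contMDiffOn_of_mem_maximalAtlas hφ).mdifferentiableOn (by simp),
    (contMDiffOn_symm_of_mem_maximalAtlas hφ).mdifferentiableOn (by simp)⟩

lemma isInvertible_mfderiv_chart_symm (hφ : φ ∈ IsManifold.maximalAtlas (𝓡 2) ∞ M) {y : Plane}
    (hy : y ∈ φ.target) : (mfderiv (𝓡 2) (𝓡 2) φ.symm y).IsInvertible :=
  ⟨(chart_mdifferentiable hφ).symm.mfderiv (x := y) (by simpa using hy), rfl⟩

lemma isInvertible_mfderiv_chart (hφ : φ ∈ IsManifold.maximalAtlas (𝓡 2) ∞ M) {x : M}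
    (hx : x ∈ φ.source) : (mfderiv (𝓡 2) (𝓡 2) φ x).IsInvertible :=
  ⟨(chart_mdifferentiable hφ).mfderiv hx, rfl⟩

lemma mfderiv_chart_symm_localRep (hφ : φ ∈ IsManifold.maximalAtlas (𝓡 2) ∞ M) {y : Plane}
    (hy : y ∈ φ.target) (X : Π x : M, TangentSpace (𝓡 2) x) :
    mfderiv (𝓡 2) (𝓡 2) φ.symm y (localRep φ X y) = X (φ.symm y) := by
  rw [localRep, VectorField.mpullback_apply]
  exact (isInvertible_mfderiv_chart_symm hφ hy).self_apply_inverse _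

lemma localRep_eq_iff (hφ : φ ∈ IsManifold.maximalAtlas (𝓡 2) ∞ M) {y : Plane}
    (hy : y ∈ φ.target) (X : Π x : M, TangentSpace (𝓡 2) x) (v : Plane) :
    localRep φ X y = v ↔ X (φ.symm y) = mfderiv (𝓡 2) (𝓡 2) φ.symm y v := by
  have h := (isInvertible_mfderiv_chart_symm hφ hy).injective.eq_iff
    (a := (localRep φ X y : TangentSpace (𝓡 2) y)) (b := (v : TangentSpace (𝓡 2) y))
  exact h.symm.trans (by rw [mfderiv_chart_symm_localRep hφ hy])

lemma mfderiv_chart_symm_eq (v : Plane) (y : Plane) :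
    mfderiv (𝓡 2) (𝓡 2) φ.symm y v = v 0 • coordVec φ 0 y + v 1 • coordVec φ 1 y := by
  have : v = v 0 • EuclideanSpace.single 0 (1 : ℝ) + v 1 • EuclideanSpace.single 1 (1 : ℝ) := by
    ext i; fin_cases i <;> simp
  conv_lhs => rw [this]
  rw [coordVec, coordVec]
  erw [map_add, map_smul, map_smul]

lemma differentiableAt_localRep (hφ : φ ∈ IsManifold.maximalAtlas (𝓡 2) ∞ M) {y : Plane}
    (hy : y ∈ φ.target) {X : Π x : M, TangentSpace (𝓡 2) x}
    (hX : MDifferentiableAt (𝓡 2) (𝓡 2).tangent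
      (fun x => (⟨x, X x⟩ : TangentBundle (𝓡 2) M)) (φ.symm y)) :
    DifferentiableAt ℝ (localRep φ X) y := by
  have h2 : (2 : WithTop ℕ∞) ≤ ∞ := WithTop.coe_le_coe.2 le_top
  have h := MDifferentiableAt.mpullback_vectorField (n := 2) hX
    ((contMDiffAt_chart_symm hφ hy).of_le h2) (isInvertible_mfderiv_chart_symm hφ hy) le_rfl
  exact mdifferentiableAt_iff_differentiableAt.1 <|
    ((contMDiff_snd_tangentBundle_modelSpace (n := 1) Plane
      𝓘(ℝ, Plane)).contMDiffAt.mdifferentiableAt one_ne_zero).comp y h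

lemma localRep_mlieBracket (hφ : φ ∈ IsManifold.maximalAtlas (𝓡 2) ∞ M) {y : Plane}
    (hy : y ∈ φ.target) {X Y : Π x : M, TangentSpace (𝓡 2) x}
    (hX : MDifferentiableAt (𝓡 2) (𝓡 2).tangent
      (fun x => (⟨x, X x⟩ : TangentBundle (𝓡 2) M)) (φ.symm y))
    (hY : MDifferentiableAt (𝓡 2) (𝓡 2).tangent
      (fun x => (⟨x, Y x⟩ : TangentBundle (𝓡 2) M)) (φ.symm y)) :
    localRep φ (VectorField.mlieBracket (𝓡 2) X Y) y =
      fderiv ℝ (localRep φ Y) y (localRep φ X y) - fderiv ℝ (localRep φ X) y (localRep φ Y y) := by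
  have h2 : minSmoothness ℝ 2 ≤ (∞ : WithTop ℕ∞) := by
    rw [minSmoothness_of_isRCLikeNormedField]; exact WithTop.coe_le_coe.2 le_top
  have := IsManifold.of_le (I := 𝓡 2) (M := M) h2
  rw [localRep, VectorField.mpullback_mlieBracket hX hY (contMDiffAt_chart_symm hφ hy) h2,
    ← VectorField.mlieBracketWithin_univ, VectorField.mlieBracketWithin_eq_lieBracketWithin]
  exact congrFun (VectorField.lieBracketWithin_univ (𝕜 := ℝ) (V := localRep φ X)
    (W := localRep φ Y)) y

end Chart

/-! ### The Levi-Civita connection in isothermal coordinates. -/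

section Isothermal

variable {M : Type*} [TopologicalSpace M] [ChartedSpace Plane M] [IsManifold (𝓡 2) ∞ M]
  [Bundle.RiemannianBundle (fun x : M => TangentSpace (𝓡 2) x)]
  {φ : OpenPartialHomeomorph M Plane} {ρ : Plane → ℝ}

/-- In the coordinates of `φ` the metric is `e^{2ρ} (dx² + dy²)`. -/
def HasConformalFactor (φ : OpenPartialHomeomorph M Plane) (ρ : Plane → ℝ) : Prop :=
  ∀ y ∈ φ.target, ∀ i j : Fin 2,
    inner ℝ (coordVec φ i y) (coordVec φ j y) = if i = j then Real.exp (2 * ρ y) else 0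

lemma HasConformalFactor.inner_mfderiv (hρ : HasConformalFactor φ ρ) {y : Plane}
    (hy : y ∈ φ.target) (v w : Plane) :
    inner ℝ (mfderiv (𝓡 2) (𝓡 2) φ.symm y v) (mfderiv (𝓡 2) (𝓡 2) φ.symm y w) =
      Real.exp (2 * ρ y) * inner ℝ v w := by
  rw [mfderiv_chart_symm_eq, mfderiv_chart_symm_eq]
  simp only [inner_add_left, inner_add_right, real_inner_smul_left, real_inner_smul_right,
    hρ y hy, PiLp.inner_apply, Fin.sum_univ_two]
  simp
  ring

lemma HasConformalFactor.inner_eq (hρ : HasConformalFactor φ ρ)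
    (hφ : φ ∈ IsManifold.maximalAtlas (𝓡 2) ∞ M) {y : Plane}
    (hy : y ∈ φ.target) (X Z : Π x : M, TangentSpace (𝓡 2) x) :
    inner ℝ (X (φ.symm y)) (Z (φ.symm y)) =
      Real.exp (2 * ρ y) * inner ℝ (localRep φ X y) (localRep φ Z y) := by
  rw [← hρ.inner_mfderiv hy, mfderiv_chart_symm_localRep hφ hy, mfderiv_chart_symm_localRep hφ hy]

variable [IsContMDiffRiemannianBundle (𝓡 2) ∞ Plane (fun x : M => TangentSpace (𝓡 2) x)]

/-- The vector field `X` is differentiable at `x`. -/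
abbrev FieldDiffAt (X : Π x : M, TangentSpace (𝓡 2) x) (x : M) : Prop :=
  MDifferentiableAt (𝓡 2) (𝓡 2).tangent (fun x => (⟨x, X x⟩ : TangentBundle (𝓡 2) M)) x

lemma HasConformalFactor.derivInner_eq (hρ : HasConformalFactor φ ρ)
    (hφ : φ ∈ IsManifold.maximalAtlas (𝓡 2) ∞ M) (hρd : ContDiffOn ℝ ∞ ρ φ.target) {y : Plane}
    (hy : y ∈ φ.target) {X Y Z : Π x : M, TangentSpace (𝓡 2) x}
    (hY : FieldDiffAt Y (φ.symm y)) (hZ : FieldDiffAt Z (φ.symm y)) :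
    derivInner X Y Z (φ.symm y) = Real.exp (2 * ρ y) *
      (2 * fderiv ℝ ρ y (localRep φ X y) * inner ℝ (localRep φ Y y) (localRep φ Z y)
        + inner ℝ (fderiv ℝ (localRep φ Y) y (localRep φ X y)) (localRep φ Z y)
        + inner ℝ (localRep φ Y y) (fderiv ℝ (localRep φ Z) y (localRep φ X y))) := by
  have := IsContMDiffRiemannianBundle.of_le (IB := 𝓡 2) (F := Plane)
    (E := fun x : M => TangentSpace (𝓡 2) x) (n := ∞) (n' := 1) (WithTop.coe_le_coe.2 le_top)
  have hd : MDifferentiableAt (𝓡 2) 𝓘(ℝ, ℝ) (fun y : M => (inner ℝ (Y y) (Z y) : ℝ))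
      (φ.symm y) := MDifferentiableAt.inner_bundle (F := Plane)
        (E := fun x : M => TangentSpace (𝓡 2) x) (b := id) hY hZ
  have h1 : derivInner X Y Z (φ.symm y) =
      fderiv ℝ (fun y' => Real.exp (2 * ρ y') * inner ℝ (localRep φ Y y') (localRep φ Z y')) y
        (localRep φ X y) := by
    rw [derivInner, ← mfderiv_chart_symm_localRep hφ hy X]
    erw [← mvfderiv_comp_apply (I := 𝓡 2) (I' := 𝓡 2) y hd
      ((contMDiffAt_chart_symm hφ hy).mdifferentiableAt (by simp))]
    have he : ((fun y : M => (inner ℝ (Y y) (Z y) : ℝ)) ∘ φ.symm) =ᶠ[𝓝 y]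
        fun y' => Real.exp (2 * ρ y') * inner ℝ (localRep φ Y y') (localRep φ Z y') := by
      filter_upwards [φ.open_target.mem_nhds hy] with z hz
      exact hρ.inner_eq hφ hz Y Z
    have h2 := he.fderiv_eq (𝕜 := ℝ)
    rw [← h2, mvfderiv]
    erw [mfderiv_eq_fderiv]
    rfl
  rw [h1]
  have hρ' : DifferentiableAt ℝ ρ y :=
    (hρd.contDiffAt (φ.open_target.mem_nhds hy)).differentiableAt (by simp)
  have hY' := differentiableAt_localRep hφ hy hY
  have hZ' := differentiableAt_localRep hφ hy hZ
  rw [HasFDerivAt.fderiv (f := fun y' => Real.exp (2 * ρ y') *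
    inner ℝ (localRep φ Y y') (localRep φ Z y')) ((hρ'.hasFDerivAt.const_mul 2).exp.mul
    (hY'.hasFDerivAt.inner ℝ hZ'.hasFDerivAt))]
  simp [fderivInnerCLM_apply]
  ring

/-- The Levi-Civita connection of the conformal metric `e^{2ρ} (dx² + dy²)` on the plane. -/
def conformalConnection (ρ : Plane → ℝ) (X Y : Plane → Plane) (y : Plane) : Plane :=
  fderiv ℝ Y y (X y) + fderiv ℝ ρ y (X y) • Y y + fderiv ℝ ρ y (Y y) • X y
    - (inner ℝ (X y) (Y y) : ℝ) • gradient ρ y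

/-- In the Koszul formula the brackets cancel the derivatives of `X` and `Z` and double the
derivative of `Y` along `X`; what remains comes from differentiating `e^{2ρ}`. Only
differentiability at the point is assumed, because the extensions of vectors are controlled only
there. -/
lemma HasConformalFactor.koszul_eq (hρ : HasConformalFactor φ ρ)
    (hφ : φ ∈ IsManifold.maximalAtlas (𝓡 2) ∞ M) (hρd : ContDiffOn ℝ ∞ ρ φ.target) {y : Plane}
    (hy : y ∈ φ.target) {X Y Z : Π x : M, TangentSpace (𝓡 2) x}
    (hX : FieldDiffAt X (φ.symm y)) (hY : FieldDiffAt Y (φ.symm y))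
    (hZ : FieldDiffAt Z (φ.symm y)) :
    koszul X Y Z (φ.symm y) = 2 * (Real.exp (2 * ρ y) *
      inner ℝ (conformalConnection ρ (localRep φ X) (localRep φ Y) y) (localRep φ Z y)) := by
  have hg (v : Plane) : inner ℝ (gradient ρ y) v = fderiv ℝ ρ y v := by
    rw [gradient, InnerProductSpace.toDual_symm_apply]
  rw [koszul, hρ.derivInner_eq hφ hρd hy hY hZ, hρ.derivInner_eq hφ hρd hy hZ hX,
    hρ.derivInner_eq hφ hρd hy hX hY, hρ.inner_eq hφ hy, hρ.inner_eq hφ hy, hρ.inner_eq hφ hy,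
    localRep_mlieBracket hφ hy hX hY, localRep_mlieBracket hφ hy hX hZ,
    localRep_mlieBracket hφ hy hY hZ]
  simp only [conformalConnection, inner_add_left, inner_sub_left, real_inner_smul_left, hg]
  rw [real_inner_comm (localRep φ X y) (localRep φ Z y),
    real_inner_comm (fderiv ℝ (localRep φ X) y (localRep φ Y y)) (localRep φ Z y),
    real_inner_comm (fderiv ℝ (localRep φ Z) y (localRep φ X y)) (localRep φ Y y),
    real_inner_comm (fderiv ℝ (localRep φ Y) y (localRep φ Z y)) (localRep φ X y)]
  ring

lemma fieldDiffAt_extendVec {x : M} (v : TangentSpace (𝓡 2) x) : FieldDiffAt (extendVec v) x :=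
  FiberBundle.mdifferentiableAt_extend (𝓡 2) Plane v

lemma extendVec_self {x : M} (v : TangentSpace (𝓡 2) x) : extendVec v x = v :=
  FiberBundle.extend_apply_self Plane v

/-- Both sides are compared through their coefficients in the orthonormal basis that defines
`leviCivita`. By the Koszul computation these do not depend on how the basis vectors are extended.
-/
lemma HasConformalFactor.leviCivita_eq (hρ : HasConformalFactor φ ρ)
    (hφ : φ ∈ IsManifold.maximalAtlas (𝓡 2) ∞ M) (hρd : ContDiffOn ℝ ∞ ρ φ.target) {y : Plane}
    (hy : y ∈ φ.target) {X Y : Π x : M, TangentSpace (𝓡 2) x}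
    (hX : FieldDiffAt X (φ.symm y)) (hY : FieldDiffAt Y (φ.symm y)) :
    localRep φ (leviCivita X Y) y =
      conformalConnection ρ (localRep φ X) (localRep φ Y) y := by
  rw [localRep_eq_iff hφ hy]
  set C := conformalConnection ρ (localRep φ X) (localRep φ Y) y
  set b := stdOrthonormalBasis ℝ (TangentSpace (𝓡 2) (φ.symm y))
  rw [leviCivita, ← b.sum_repr (mfderiv (𝓡 2) (𝓡 2) φ.symm y C)]
  refine Finset.sum_congr rfl fun i _ => ?_
  congr 1
  rw [hρ.koszul_eq hφ hρd hy hX hY (fieldDiffAt_extendVec _), ← hρ.inner_mfderiv hy,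
    mfderiv_chart_symm_localRep hφ hy, extendVec_self, b.repr_apply_apply, real_inner_comm]
  ring

end Isothermal

end RiemSurf

end

/-! ### Tensor fields and their covariant derivative in isothermal coordinates. -/

noncomputable section

namespace RiemSurf

open Set Filter Topology

section Tensor

variable {M : Type*} [TopologicalSpace M] [ChartedSpace Plane M] [IsManifold (𝓡 2) ∞ M]
  {φ : OpenPartialHomeomorph M Plane}

/-- The vector field on the domain of the chart `φ` with constant coordinates `v`. -/
def coordField (φ : OpenPartialHomeomorph M Plane) (v : Plane) : Π x : M, TangentSpace (𝓡 2) x :=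
  VectorField.mpullback (𝓡 2) (𝓡 2) φ (fun _ => (v : Plane))

lemma contMDiffAt_coordField (hφ : φ ∈ IsManifold.maximalAtlas (𝓡 2) ∞ M) {x : M}
    (hx : x ∈ φ.source) (v : Plane) :
    ContMDiffAt (𝓡 2) (𝓡 2).tangent ∞
      (fun x => (⟨x, coordField φ v x⟩ : TangentBundle (𝓡 2) M)) x := by
  refine ContMDiffAt.mpullback_vectorField_preimage (n := ∞) (m := ∞) (V := fun _ => (v : Plane)) ?_
    (contMDiffAt_of_mem_maximalAtlas hφ hx) (isInvertible_mfderiv_chart hφ hx) (by simp)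
  exact contMDiffAt_vectorSpace_iff_contDiffAt.2 contDiffAt_const

lemma fieldDiffAt_coordField (hφ : φ ∈ IsManifold.maximalAtlas (𝓡 2) ∞ M) {x : M}
    (hx : x ∈ φ.source) (v : Plane) : FieldDiffAt (coordField φ v) x :=
  (contMDiffAt_coordField hφ hx v).mdifferentiableAt (by simp)

lemma localRep_coordField (hφ : φ ∈ IsManifold.maximalAtlas (𝓡 2) ∞ M) {y : Plane}
    (hy : y ∈ φ.target) (v : Plane) : localRep φ (coordField φ v) y = v := by
  rw [localRep_eq_iff hφ hy]
  have hx := φ.map_target hy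
  refine (isInvertible_mfderiv_chart hφ hx).injective ?_
  have h1 := (chart_mdifferentiable hφ).comp_symm_deriv hy
  have h2 := (isInvertible_mfderiv_chart hφ hx).self_apply_inverse (v : Plane)
  have h3 : mfderiv (𝓡 2) (𝓡 2) φ (φ.symm y) (mfderiv (𝓡 2) (𝓡 2) φ.symm y v) = v :=
    congrArg (fun L => L v) h1
  exact h2.trans h3.symm

/-- The matrix field of the tensor field `T` in the chart `φ`. -/
def tensorRep (φ : OpenPartialHomeomorph M Plane)
    (T : Π x : M, TangentSpace (𝓡 2) x →L[ℝ] TangentSpace (𝓡 2) x) (y : Plane) :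
    Plane →L[ℝ] Plane :=
  (mfderiv (𝓡 2) (𝓡 2) φ.symm y).inverse ∘L T (φ.symm y) ∘L mfderiv (𝓡 2) (𝓡 2) φ.symm y

variable {T : Π x : M, TangentSpace (𝓡 2) x →L[ℝ] TangentSpace (𝓡 2) x}

lemma mfderiv_tensorRep (hφ : φ ∈ IsManifold.maximalAtlas (𝓡 2) ∞ M) {y : Plane}
    (hy : y ∈ φ.target) (v : Plane) :
    mfderiv (𝓡 2) (𝓡 2) φ.symm y (tensorRep φ T y v) =
      T (φ.symm y) (mfderiv (𝓡 2) (𝓡 2) φ.symm y v) :=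
  (isInvertible_mfderiv_chart_symm hφ hy).self_apply_inverse _

lemma localRep_tensor (hφ : φ ∈ IsManifold.maximalAtlas (𝓡 2) ∞ M) {y : Plane}
    (hy : y ∈ φ.target) (X : Π x : M, TangentSpace (𝓡 2) x) :
    localRep φ (fun x => T x (X x)) y = tensorRep φ T y (localRep φ X y) := by
  rw [localRep_eq_iff hφ hy, mfderiv_tensorRep hφ hy, mfderiv_chart_symm_localRep hφ hy]

lemma IsSmoothTensor.fieldDiffAt (hT : IsSmoothTensor T) {X : Π x : M, TangentSpace (𝓡 2) x}
    {x : M} (hX : FieldDiffAt X x) : FieldDiffAt (fun x => T x (X x)) x :=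
  MDifferentiableAt.clm_bundle_apply (b := id) (E₁ := fun x : M => TangentSpace (𝓡 2) x)
    (E₂ := fun x : M => TangentSpace (𝓡 2) x) (F₁ := Plane) (F₂ := Plane)
    ((hT x).mdifferentiableAt (by simp)) hX

/-- The columns of the matrix represent `T` applied to the fields with constant coordinates, which
are differentiable; the matrix field is a continuous linear function of its columns. -/
lemma IsSmoothTensor.differentiableAt (hT : IsSmoothTensor T)
    (hφ : φ ∈ IsManifold.maximalAtlas (𝓡 2) ∞ M) {y : Plane} (hy : y ∈ φ.target) :
    DifferentiableAt ℝ (tensorRep φ T) y := by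
  have key (v : Plane) : DifferentiableAt ℝ (fun z => tensorRep φ T z v) y := by
    have h := differentiableAt_localRep hφ hy
      (hT.fieldDiffAt (fieldDiffAt_coordField hφ (φ.map_target hy) v))
    refine h.congr_of_eventuallyEq ?_
    filter_upwards [φ.open_target.mem_nhds hy] with z hz
    rw [localRep_tensor hφ hz, localRep_coordField hφ hz]
  let L (i : Fin 2) : Plane →L[ℝ] Plane →L[ℝ] Plane :=
    ContinuousLinearMap.smulRightL ℝ Plane Plane (EuclideanSpace.proj i)
  have h : tensorRep φ T = fun z => ∑ i, L i (tensorRep φ T z (EuclideanSpace.single i 1)) := by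
    ext1 z
    refine ContinuousLinearMap.ext fun v => ?_
    have hv : v = ∑ i, v i • EuclideanSpace.single i (1 : ℝ) := by
      ext i; fin_cases i <;> simp
    conv_lhs => rw [hv, map_sum]
    simp [L]
  rw [h]
  exact DifferentiableAt.fun_sum fun i _ => (L i).differentiableAt.comp y (key _)

/-- The value `(∇_u T)(v)` of the covariant derivative of a tensor field with matrix `A` for the
conformal metric `e^{2ρ} (dx² + dy²)` on the plane. -/
def conformalNabla (ρ : Plane → ℝ) (A : Plane → Plane →L[ℝ] Plane) (y u v : Plane) : Plane :=
  fderiv ℝ A y u v + fderiv ℝ ρ y (A y v) • u - (inner ℝ u (A y v) : ℝ) • gradient ρ y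
    - fderiv ℝ ρ y v • A y u + (inner ℝ u v : ℝ) • A y (gradient ρ y)

variable [Bundle.RiemannianBundle (fun x : M => TangentSpace (𝓡 2) x)] {ρ : Plane → ℝ}
  [IsContMDiffRiemannianBundle (𝓡 2) ∞ Plane (fun x : M => TangentSpace (𝓡 2) x)]

/-- The derivative of `Y` and the terms `dρ(X) T(Y)` cancel in `∇_X (T Y) - T (∇_X Y)`. The result
is tensorial: it depends only on the values of `X` and `Y` at the point. -/
lemma HasConformalFactor.nablaTensor_eq (hρ : HasConformalFactor φ ρ)
    (hφ : φ ∈ IsManifold.maximalAtlas (𝓡 2) ∞ M) (hρd : ContDiffOn ℝ ∞ ρ φ.target)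
    (hT : IsSmoothTensor T) {y : Plane}
    (hy : y ∈ φ.target) {X Y : Π x : M, TangentSpace (𝓡 2) x}
    (hX : FieldDiffAt X (φ.symm y)) (hY : FieldDiffAt Y (φ.symm y)) :
    localRep φ (nablaTensor T X Y) y =
      conformalNabla ρ (tensorRep φ T) y (localRep φ X y) (localRep φ Y y) := by
  have h0 : localRep φ (nablaTensor T X Y) y = localRep φ (leviCivita X (fun x => T x (Y x))) y -
      tensorRep φ T y (localRep φ (leviCivita X Y) y) := by
    rw [← localRep_tensor hφ hy]
    exact map_sub (mfderiv (𝓡 2) (𝓡 2) φ.symm y).inverse _ _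
  have he : localRep φ (fun x => T x (Y x)) =ᶠ[𝓝 y]
      fun z => tensorRep φ T z (localRep φ Y z) := by
    filter_upwards [φ.open_target.mem_nhds hy] with z hz
    exact localRep_tensor hφ hz Y
  rw [h0, hρ.leviCivita_eq hφ hρd hy hX (hT.fieldDiffAt hY), hρ.leviCivita_eq hφ hρd hy hX hY,
    conformalConnection, conformalConnection, conformalNabla, he.fderiv_eq, he.eq_of_nhds,
    fderiv_clm_apply (hT.differentiableAt hφ hy) (differentiableAt_localRep hφ hy hY)]
  simp only [add_apply, ContinuousLinearMap.comp_apply,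
    ContinuousLinearMap.flip_apply, map_add, map_sub, map_smul]
  abel

/-- At the point with coordinates `y`, a bilinear map applied to the orthonormal basis. -/
lemma OrthonormalBasis.sum_bilin_eq {E F ι ι' : Type*} [NormedAddCommGroup E]
    [InnerProductSpace ℝ E] [AddCommGroup F] [Module ℝ F] [Fintype ι] [Fintype ι']
    (b : OrthonormalBasis ι ℝ E) (b' : OrthonormalBasis ι' ℝ E) (B : E →ₗ[ℝ] E →ₗ[ℝ] F) :
    ∑ i, B (b i) (b i) = ∑ j, B (b' j) (b' j) := by
  classical
  have h (i : ι) : B (b i) (b i) =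
      ∑ j, ∑ k, (inner ℝ (b' j) (b i) * inner ℝ (b i) (b' k) : ℝ) • B (b' j) (b' k) := by
    conv_lhs => rw [← b'.sum_repr (b i)]
    simp only [map_sum, map_smul, LinearMap.sum_apply, LinearMap.smul_apply,
      b'.repr_apply_apply, Finset.smul_sum, smul_smul]
    rw [Finset.sum_comm]
    refine Finset.sum_congr rfl fun j _ => Finset.sum_congr rfl fun k _ => ?_
    rw [real_inner_comm (b i) (b' k)]
    congr 1
    try ring
  simp only [h]
  rw [Finset.sum_comm]
  refine Finset.sum_congr rfl fun j _ => ?_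
  rw [Finset.sum_comm]
  -- Parseval for `b` reduces the coefficient of `B (b' j) (b' k)` to the inner product of `b' j`
  -- and `b' k`.
  simp only [← Finset.sum_smul, b.sum_inner_mul_inner, orthonormal_iff_ite.1 b'.orthonormal]
  simp

end Tensor

end RiemSurf

end

/-! ### The four conditions as linear equations at a point. -/

noncomputable section

namespace RiemSurf

open Set Filter Topology

/-- The coordinate vectors of the plane. -/
abbrev unitVec (i : Fin 2) : Plane := EuclideanSpace.single i 1

/-- The entries of a field of endomorphisms of the plane. -/
def entry (A : Plane → Plane →L[ℝ] Plane) (i j : Fin 2) (y : Plane) : ℝ := A y (unitVec j) i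

/-- The partial derivatives of a function on the plane. -/
def pd (i : Fin 2) (f : Plane → ℝ) (y : Plane) : ℝ := fderiv ℝ f y (unitVec i)

lemma pd_entry {A : Plane → Plane →L[ℝ] Plane} {y : Plane} (hA : DifferentiableAt ℝ A y)
    (i j k : Fin 2) : pd k (entry A i j) y = fderiv ℝ A y (unitVec k) (unitVec j) i := by
  have h : HasFDerivAt (entry A i j) ((EuclideanSpace.proj i : Plane →L[ℝ] ℝ) ∘L
      ((ContinuousLinearMap.apply ℝ Plane (unitVec j)) ∘L fderiv ℝ A y)) y :=
    ((EuclideanSpace.proj i : Plane →L[ℝ] ℝ).hasFDerivAt).comp y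
      (((ContinuousLinearMap.apply ℝ Plane (unitVec j)).hasFDerivAt).comp y hA.hasFDerivAt)
  rw [pd, h.fderiv]
  rfl

lemma differentiableAt_entry {A : Plane → Plane →L[ℝ] Plane} {y : Plane}
    (hA : DifferentiableAt ℝ A y) (i j : Fin 2) : DifferentiableAt ℝ (entry A i j) y :=
  (EuclideanSpace.proj i : Plane →L[ℝ] ℝ).differentiableAt.comp y
    ((ContinuousLinearMap.apply ℝ Plane (unitVec j)).differentiableAt.comp y hA)

lemma gradient_apply_eq_pd (ρ : Plane → ℝ) (y : Plane) (i : Fin 2) :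
    gradient ρ y i = pd i ρ y := by
  have : inner ℝ (gradient ρ y) (unitVec i) = fderiv ℝ ρ y (unitVec i) := by
    rw [gradient, InnerProductSpace.toDual_symm_apply]
  rw [pd, ← this, EuclideanSpace.inner_single_right]
  simp

lemma plane_eq_sum (v : Plane) : v = v 0 • unitVec 0 + v 1 • unitVec 1 := by
  ext i; fin_cases i <;> simp

lemma clm_apply_eq_entry (A : Plane → Plane →L[ℝ] Plane) (y v : Plane) (i : Fin 2) :
    A y v i = v 0 * entry A i 0 y + v 1 * entry A i 1 y := by
  conv_lhs => rw [plane_eq_sum v, map_add, map_smul, map_smul]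
  rfl

lemma fderiv_apply_eq_pd (f : Plane → ℝ) (y v : Plane) :
    fderiv ℝ f y v = v 0 * pd 0 f y + v 1 * pd 1 f y := by
  conv_lhs => rw [plane_eq_sum v, map_add, map_smul, map_smul]
  rfl

/-- The divergence equations for a symmetric matrix field, at a point. -/
def DivEq (ρ : Plane → ℝ) (A : Plane → Plane →L[ℝ] Plane) (y : Plane) : Prop :=
  pd 0 (entry A 0 0) y + pd 1 (entry A 1 0) y + (entry A 0 0 y - entry A 1 1 y) * pd 0 ρ y
      + 2 * entry A 1 0 y * pd 1 ρ y = 0 ∧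
    pd 0 (entry A 1 0) y + pd 1 (entry A 1 1) y + 2 * entry A 1 0 y * pd 0 ρ y
      + (entry A 1 1 y - entry A 0 0 y) * pd 1 ρ y = 0

/-- The Codazzi equations for a symmetric matrix field, at a point. -/
def CodazziEq (ρ : Plane → ℝ) (A : Plane → Plane →L[ℝ] Plane) (y : Plane) : Prop :=
  pd 0 (entry A 1 0) y - pd 1 (entry A 0 0) y + 2 * pd 0 ρ y * entry A 1 0 y
      + pd 1 ρ y * (entry A 1 1 y - entry A 0 0 y) = 0 ∧
    pd 0 (entry A 1 1) y - pd 1 (entry A 1 0) y + pd 0 ρ y * (entry A 1 1 y - entry A 0 0 y)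
      - 2 * pd 1 ρ y * entry A 1 0 y = 0

/-- The trace of the matrix field is stationary, at a point. -/
def TraceEq (A : Plane → Plane →L[ℝ] Plane) (y : Plane) : Prop :=
  pd 0 (entry A 0 0) y + pd 0 (entry A 1 1) y = 0 ∧
    pd 1 (entry A 0 0) y + pd 1 (entry A 1 1) y = 0

/-- The Cauchy-Riemann equations for the Hopf function of a symmetric matrix field, at a point. -/
def HopfEq (ρ : Plane → ℝ) (A : Plane → Plane →L[ℝ] Plane) (y : Plane) : Prop :=
  pd 0 (entry A 0 0) y - pd 0 (entry A 1 1) y + 2 * pd 1 (entry A 1 0) y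
      + 2 * pd 0 ρ y * (entry A 0 0 y - entry A 1 1 y) + 4 * pd 1 ρ y * entry A 1 0 y = 0 ∧
    pd 1 (entry A 0 0) y - pd 1 (entry A 1 1) y - 2 * pd 0 (entry A 1 0) y
      + 2 * pd 1 ρ y * (entry A 0 0 y - entry A 1 1 y) - 4 * pd 0 ρ y * entry A 1 0 y = 0

section Equations

variable {ρ : Plane → ℝ} {A : Plane → Plane →L[ℝ] Plane} {y : Plane}

/-- Let `D`, `C`, `t`, `H` be the left-hand sides of the divergence, Codazzi, trace and Hopf
equations. Then `C₁ = D₂ - t₂`, `C₂ = t₁ - D₁`, `H₁ = 2 D₁ - t₁` and `H₂ = t₂ - 2 D₂`. This lemma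
and the next four are read off from these relations. -/
lemma DivEq.hopf_iff_trace (h : DivEq ρ A y) : HopfEq ρ A y ↔ TraceEq A y := by
  obtain ⟨h1, h2⟩ := h
  constructor <;> rintro ⟨h3, h4⟩ <;> constructor <;> linarith

lemma DivEq.codazzi_iff_trace (h : DivEq ρ A y) : CodazziEq ρ A y ↔ TraceEq A y := by
  obtain ⟨h1, h2⟩ := h
  constructor <;> rintro ⟨h3, h4⟩ <;> constructor <;> linarith

lemma TraceEq.hopf_iff_div (h : TraceEq A y) : HopfEq ρ A y ↔ DivEq ρ A y := by
  obtain ⟨h1, h2⟩ := h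
  constructor <;> rintro ⟨h3, h4⟩ <;> constructor <;> linarith

lemma TraceEq.codazzi_iff_div (h : TraceEq A y) : CodazziEq ρ A y ↔ DivEq ρ A y := by
  obtain ⟨h1, h2⟩ := h
  constructor <;> rintro ⟨h3, h4⟩ <;> constructor <;> linarith

lemma HopfEq.trace_of_codazzi (h : HopfEq ρ A y) (h' : CodazziEq ρ A y) : TraceEq A y := by
  obtain ⟨h1, h2⟩ := h
  obtain ⟨h3, h4⟩ := h'
  constructor <;> linarith

/-- Symmetry is needed in a neighbourhood, not only at `y`, since the partial derivatives of the
off-diagonal entries have to be identified as well. -/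
lemma sum_conformalNabla_eq_zero_iff (hA : DifferentiableAt ℝ A y)
    (hs : entry A 0 1 =ᶠ[𝓝 y] entry A 1 0) :
    ∑ i, conformalNabla ρ A y (unitVec i) (unitVec i) = 0 ↔ DivEq ρ A y := by
  have h01 := hs.eq_of_nhds
  have hp (k : Fin 2) : pd k (entry A 0 1) y = pd k (entry A 1 0) y := by
    rw [pd, pd, hs.fderiv_eq]
  have e (v : Plane) : v = 0 ↔ v 0 = 0 ∧ v 1 = 0 := by
    constructor
    · rintro rfl; simp
    · rintro ⟨h0, h1⟩; ext i; fin_cases i <;> simp [h0, h1]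
  rw [e, DivEq]
  simp only [Fin.sum_univ_two, conformalNabla, PiLp.add_apply, PiLp.sub_apply, PiLp.smul_apply,
    ← pd_entry hA, gradient_apply_eq_pd, clm_apply_eq_entry A, fderiv_apply_eq_pd ρ, hp,
    PiLp.inner_apply, Fin.sum_univ_two, h01]
  simp
  constructor <;> rintro ⟨h1, h2⟩ <;> constructor <;> linarith

lemma conformalNabla_symm_iff (hA : DifferentiableAt ℝ A y)
    (hs : entry A 0 1 =ᶠ[𝓝 y] entry A 1 0) :
    (∀ u v, conformalNabla ρ A y u v = conformalNabla ρ A y v u) ↔ CodazziEq ρ A y := by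
  have h01 := hs.eq_of_nhds
  have hp (k : Fin 2) : pd k (entry A 0 1) y = pd k (entry A 1 0) y := by
    rw [pd, pd, hs.fderiv_eq]
  have e (v w : Plane) : v = w ↔ v 0 = w 0 ∧ v 1 = w 1 := by
    constructor
    · rintro rfl; simp
    · rintro ⟨h0, h1⟩; ext i; fin_cases i <;> simp [h0, h1]
  have hD (u v : Plane) (i : Fin 2) : fderiv ℝ A y u v i =
      u 0 * v 0 * pd 0 (entry A i 0) y + u 0 * v 1 * pd 0 (entry A i 1) y
      + u 1 * v 0 * pd 1 (entry A i 0) y + u 1 * v 1 * pd 1 (entry A i 1) y := by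
    simp only [pd_entry hA]
    conv_lhs => rw [plane_eq_sum u, plane_eq_sum v]
    simp
    ring
  simp only [e, CodazziEq]
  simp only [Fin.sum_univ_two, conformalNabla, PiLp.add_apply, PiLp.sub_apply, PiLp.smul_apply,
    hD, gradient_apply_eq_pd, clm_apply_eq_entry A, fderiv_apply_eq_pd ρ, hp,
    PiLp.inner_apply, Fin.sum_univ_two, h01]
  constructor
  · intro h
    -- The difference of the two sides is bilinear and alternating in `u` and `v`, so in the plane
    -- it is `u 0 * v 1 - u 1 * v 0` times its value on the coordinate vectors.
    obtain ⟨h1, h2⟩ := h (unitVec 0) (unitVec 1)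
    simp at h1 h2
    constructor <;> linarith
  · rintro ⟨h1, h2⟩ u v
    simp
    constructor
    · linear_combination (u 0 * v 1 - u 1 * v 0) * h1
    · linear_combination (u 0 * v 1 - u 1 * v 0) * h2

end Equations

end RiemSurf

end

/-! ### From the invariant conditions to the coordinate equations. -/

noncomputable section

namespace RiemSurf

open Set Filter Topology

section Conditions

variable {M : Type*} [TopologicalSpace M] [ChartedSpace Plane M] [IsManifold (𝓡 2) ∞ M]
  {φ : OpenPartialHomeomorph M Plane}
  {T : Π x : M, TangentSpace (𝓡 2) x →L[ℝ] TangentSpace (𝓡 2) x}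

lemma exists_chartEquiv (hφ : φ ∈ IsManifold.maximalAtlas (𝓡 2) ∞ M) {y : Plane}
    (hy : y ∈ φ.target) : ∃ L : Plane ≃L[ℝ] TangentSpace (𝓡 2) (φ.symm y),
      ∀ v : Plane, mfderiv (𝓡 2) (𝓡 2) φ.symm y v = L v := by
  obtain ⟨L, hL⟩ := isInvertible_mfderiv_chart_symm hφ hy
  exact ⟨L, fun v => by rw [← hL]; rfl⟩

lemma tensorTrace_chart (hφ : φ ∈ IsManifold.maximalAtlas (𝓡 2) ∞ M) {y : Plane}
    (hy : y ∈ φ.target) :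
    tensorTrace T (φ.symm y) = entry (tensorRep φ T) 0 0 y + entry (tensorRep φ T) 1 1 y := by
  obtain ⟨L, hL⟩ := exists_chartEquiv hφ hy
  have h1 : (T (φ.symm y)).toLinearMap =
      L.toLinearEquiv.conj (tensorRep φ T y : Plane →ₗ[ℝ] Plane) := by
    refine LinearMap.ext fun v => ?_
    obtain ⟨w, rfl⟩ := L.surjective v
    have h2 := mfderiv_tensorRep (T := T) hφ hy w
    rw [hL, hL] at h2
    rw [LinearEquiv.conj_apply_apply]
    refine h2.symm.trans ?_
    exact congrArg (fun z => L (tensorRep φ T y z)) (L.symm_apply_apply w).symm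
  rw [tensorTrace, h1, LinearMap.trace_conj',
    LinearMap.trace_eq_matrix_trace ℝ (EuclideanSpace.basisFun (Fin 2) ℝ).toBasis]
  simp [Matrix.trace, LinearMap.toMatrix_apply, entry]

variable [Bundle.RiemannianBundle (fun x : M => TangentSpace (𝓡 2) x)] {ρ : Plane → ℝ}

/-- A conformal metric has the same symmetric endomorphisms as the Euclidean one, because the factor
`e^{2ρ}` cancels. -/
lemma HasConformalFactor.entry_symm (hρ : HasConformalFactor φ ρ)
    (hφ : φ ∈ IsManifold.maximalAtlas (𝓡 2) ∞ M) (hs : IsSymmetricTensor T) {y : Plane}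
    (hy : y ∈ φ.target) : entry (tensorRep φ T) 0 1 y = entry (tensorRep φ T) 1 0 y := by
  have h := hs (φ.symm y) (mfderiv (𝓡 2) (𝓡 2) φ.symm y (unitVec 0))
    (mfderiv (𝓡 2) (𝓡 2) φ.symm y (unitVec 1))
  rw [← mfderiv_tensorRep hφ hy, ← mfderiv_tensorRep hφ hy] at h
  erw [hρ.inner_mfderiv hy, hρ.inner_mfderiv hy] at h
  have h' := mul_left_cancel₀ (Real.exp_ne_zero _) h
  rw [EuclideanSpace.inner_single_right, EuclideanSpace.inner_single_left] at h'
  simpa [entry] using h'.symm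

lemma HasConformalFactor.entry_symm_eventually (hρ : HasConformalFactor φ ρ)
    (hφ : φ ∈ IsManifold.maximalAtlas (𝓡 2) ∞ M) (hs : IsSymmetricTensor T) {y : Plane}
    (hy : y ∈ φ.target) : entry (tensorRep φ T) 0 1 =ᶠ[𝓝 y] entry (tensorRep φ T) 1 0 := by
  filter_upwards [φ.open_target.mem_nhds hy] with z hz
  exact hρ.entry_symm hφ hs hz

lemma HasConformalFactor.hopf_eq (hρ : HasConformalFactor φ ρ)
    (hφ : φ ∈ IsManifold.maximalAtlas (𝓡 2) ∞ M) (hs : IsSymmetricTensor T) {y : Plane}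
    (hy : y ∈ φ.target) :
    hopf T φ y = (1 / 4 : ℂ) * Real.exp (2 * ρ y) *
      (entry (tensorRep φ T) 0 0 y - entry (tensorRep φ T) 1 1 y
        - 2 * Complex.I * entry (tensorRep φ T) 1 0 y) := by
  have hT (i j : Fin 2) : innerₗ _ ((T (φ.symm y)).toLinearMap (coordVec φ i y))
      (coordVec φ j y) = Real.exp (2 * ρ y) * entry (tensorRep φ T) j i y := by
    change inner ℝ (T (φ.symm y) (coordVec φ i y)) (coordVec φ j y) = _
    rw [coordVec, coordVec, ← mfderiv_tensorRep hφ hy, hρ.inner_mfderiv hy,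
      EuclideanSpace.inner_single_right]
    simp [entry]
  simp only [hopf, complexMetric, dz, map_smul, map_sub, LinearMap.baseChange_tmul,
    LinearMap.smul_apply, LinearMap.sub_apply, LinearMap.BilinForm.baseChange_tmul]
  rw [hT, hT, hT, hT, hρ.entry_symm hφ hs hy]
  simp only [smul_eq_mul, Complex.real_smul, Complex.ofReal_mul, mul_one, one_mul]
  ring_nf
  simp only [Complex.I_sq]
  ring

lemma toPlane_eq_repr (z : ℂ) : toPlane z = Complex.orthonormalBasisOneI.repr z := by
  ext i; fin_cases i <;> simp [toPlane]

lemma hasFDerivAt_toPlane (z : ℂ) :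
    HasFDerivAt toPlane (Complex.orthonormalBasisOneI.repr.toContinuousLinearEquiv :
      ℂ →L[ℝ] Plane) z := by
  have : toPlane = Complex.orthonormalBasisOneI.repr := funext toPlane_eq_repr
  rw [this]
  exact Complex.orthonormalBasisOneI.repr.toContinuousLinearEquiv.hasFDerivAt

/-- The Cauchy-Riemann equations on the plane. -/
lemma differentiableAt_add_I_mul_iff {U V : Plane → ℝ} {z : ℂ}
    (hU : DifferentiableAt ℝ U (toPlane z)) (hV : DifferentiableAt ℝ V (toPlane z)) :
    DifferentiableAt ℂ (fun z => (U (toPlane z) : ℂ) + Complex.I * V (toPlane z)) z ↔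
      pd 0 U (toPlane z) = pd 1 V (toPlane z) ∧ pd 1 U (toPlane z) = -pd 0 V (toPlane z) := by
  have hP := hasFDerivAt_toPlane z
  have hU' := Complex.ofRealCLM.hasFDerivAt.comp z (hU.hasFDerivAt.comp z hP)
  have hV' := (Complex.ofRealCLM.hasFDerivAt.comp z (hV.hasFDerivAt.comp z hP)).const_mul Complex.I
  have h : HasFDerivAt (fun z => (U (toPlane z) : ℂ) + Complex.I * V (toPlane z)) _ z :=
    hU'.add hV'
  rw [differentiableAt_complex_iff_differentiableAt_real, h.fderiv]
  have e0 : Complex.orthonormalBasisOneI.repr 1 = unitVec 0 := by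
    rw [← toPlane_eq_repr]; ext i; fin_cases i <;> simp [toPlane]
  have e1 : Complex.orthonormalBasisOneI.repr Complex.I = unitVec 1 := by
    rw [← toPlane_eq_repr]; ext i; fin_cases i <;> simp [toPlane]
  simp only [h.differentiableAt, true_and]
  simp only [add_apply, ContinuousLinearMap.comp_apply, smul_apply,
    ContinuousLinearEquiv.coe_coe, LinearIsometryEquiv.coe_toContinuousLinearEquiv, e0, e1,
    Complex.ofRealCLM_apply, smul_eq_mul, Complex.ext_iff]
  simp [pd]
  constructor <;> rintro ⟨h1, h2⟩ <;> constructor <;> linarith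

lemma pd_exp_mul {ρ u : Plane → ℝ} {y : Plane} (hρ : DifferentiableAt ℝ ρ y)
    (hu : DifferentiableAt ℝ u y) (i : Fin 2) (c : ℝ) :
    pd i (fun y => c * (Real.exp (2 * ρ y) * u y)) y =
      c * (Real.exp (2 * ρ y) * (2 * pd i ρ y * u y + pd i u y)) := by
  rw [pd, HasFDerivAt.fderiv (f := fun y => c * (Real.exp (2 * ρ y) * u y))
    (((hρ.hasFDerivAt.const_mul 2).exp.mul hu.hasFDerivAt).const_mul c)]
  simp [pd]
  ring

/-- These are the Cauchy-Riemann equations for `e^{2ρ} (a₀₀ - a₁₁ - 2i a₁₀) / 4`. Differentiating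
the exponential produces the terms in `ρ`, and the common factor `e^{2ρ}` is then divided out. -/
lemma HasConformalFactor.differentiableAt_hopf_iff (hρ : HasConformalFactor φ ρ)
    (hφ : φ ∈ IsManifold.maximalAtlas (𝓡 2) ∞ M) (hρd : ContDiffOn ℝ ∞ ρ φ.target)
    (hT : IsSmoothTensor T) (hs : IsSymmetricTensor T) {z : ℂ} (hz : toPlane z ∈ φ.target) :
    DifferentiableAt ℂ (fun z => hopf T φ (toPlane z)) z ↔
      HopfEq ρ (tensorRep φ T) (toPlane z) := by
  set A := tensorRep φ T
  have hA : DifferentiableAt ℝ A (toPlane z) := hT.differentiableAt hφ hz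
  have hρ' : DifferentiableAt ℝ ρ (toPlane z) :=
    (hρd.contDiffAt (φ.open_target.mem_nhds hz)).differentiableAt (by simp)
  have h00 := differentiableAt_entry hA 0 0
  have h11 := differentiableAt_entry hA 1 1
  have h10 := differentiableAt_entry hA 1 0
  have hsub := h00.sub h11
  let U : Plane → ℝ := fun y => 1 / 4 * (Real.exp (2 * ρ y) * (entry A 0 0 - entry A 1 1) y)
  let V : Plane → ℝ := fun y => -(1 / 2) * (Real.exp (2 * ρ y) * entry A 1 0 y)
  have hU : DifferentiableAt ℝ U (toPlane z) := ((hρ'.const_mul 2).exp.mul hsub).const_mul _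
  have hV : DifferentiableAt ℝ V (toPlane z) := ((hρ'.const_mul 2).exp.mul h10).const_mul _
  have he : (fun z => hopf T φ (toPlane z)) =ᶠ[𝓝 z]
      fun z => (U (toPlane z) : ℂ) + Complex.I * V (toPlane z) := by
    filter_upwards [(hasFDerivAt_toPlane z).continuousAt.preimage_mem_nhds
      (φ.open_target.mem_nhds hz)] with w hw
    rw [hρ.hopf_eq hφ hs hw]
    simp only [U, V, A, Pi.sub_apply]
    push_cast
    ring
  have hpd (i : Fin 2) : pd i (entry A 0 0 - entry A 1 1) (toPlane z) =
      pd i (entry A 0 0) (toPlane z) - pd i (entry A 1 1) (toPlane z) := by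
    rw [pd, fderiv_sub h00 h11]; rfl
  rw [he.differentiableAt_iff, differentiableAt_add_I_mul_iff hU hV, HopfEq]
  simp only [U, V]
  rw [pd_exp_mul hρ' hsub, pd_exp_mul hρ' hsub, pd_exp_mul hρ' h10, pd_exp_mul hρ' h10, hpd, hpd]
  have hexp := Real.exp_ne_zero (2 * ρ (toPlane z))
  simp only [Pi.sub_apply]
  constructor <;> rintro ⟨h1, h2⟩ <;> constructor
  · refine mul_left_cancel₀ hexp ?_; linear_combination 4 * h1
  · refine mul_left_cancel₀ hexp ?_; linear_combination 4 * h2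
  · linear_combination (1 / 4) * Real.exp (2 * ρ (toPlane z)) * h1
  · linear_combination (1 / 4) * Real.exp (2 * ρ (toPlane z)) * h2

variable [IsContMDiffRiemannianBundle (𝓡 2) ∞ Plane (fun x : M => TangentSpace (𝓡 2) x)]

lemma HasConformalFactor.nablaTensor_symm_iff (hρ : HasConformalFactor φ ρ)
    (hφ : φ ∈ IsManifold.maximalAtlas (𝓡 2) ∞ M) (hρd : ContDiffOn ℝ ∞ ρ φ.target)
    (hT : IsSmoothTensor T) {y : Plane} (hy : y ∈ φ.target)
    {X Y : Π x : M, TangentSpace (𝓡 2) x}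
    (hX : FieldDiffAt X (φ.symm y)) (hY : FieldDiffAt Y (φ.symm y)) :
    nablaTensor T X Y (φ.symm y) = nablaTensor T Y X (φ.symm y) ↔
      conformalNabla ρ (tensorRep φ T) y (localRep φ X y) (localRep φ Y y) =
        conformalNabla ρ (tensorRep φ T) y (localRep φ Y y) (localRep φ X y) := by
  obtain ⟨L, hL⟩ := exists_chartEquiv hφ hy
  rw [← hρ.nablaTensor_eq hφ hρd hT hy hX hY, ← hρ.nablaTensor_eq hφ hρd hT hy hY hX,
    ← mfderiv_chart_symm_localRep hφ hy (nablaTensor T X Y),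
    ← mfderiv_chart_symm_localRep hφ hy (nablaTensor T Y X), hL, hL, L.injective.eq_iff]

/-- The bilinear map `(u, v) ↦ (∇_u T)(v)` of a conformal metric on the plane. -/
def conformalNablaₗ (ρ : Plane → ℝ) (A : Plane → Plane →L[ℝ] Plane) (y : Plane) :
    Plane →ₗ[ℝ] Plane →ₗ[ℝ] Plane :=
  LinearMap.mk₂ ℝ (conformalNabla ρ A y)
    (fun u u' v => by
      simp only [conformalNabla, map_add, add_apply, inner_add_left, add_smul, smul_add]; abel)
    (fun c u v => by
      simp only [conformalNabla, map_smul, smul_apply, real_inner_smul_left, smul_sub, smul_add,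
        mul_smul]
      rw [smul_comm c (fderiv ℝ ρ y (A y v)), smul_comm c (fderiv ℝ ρ y v)])
    (fun u v v' => by
      simp only [conformalNabla, map_add, inner_add_right, add_smul]; abel)
    (fun c u v => by
      simp only [conformalNabla, map_smul, real_inner_smul_right, smul_sub, smul_add,
        mul_smul, smul_eq_mul])

/-- The differential of the inverse chart divided by `e^ρ` is an isometry, so it can carry the
orthonormal basis used in `divTensor` back to the Euclidean plane. -/
lemma HasConformalFactor.exists_isometry (hρ : HasConformalFactor φ ρ)
    (hφ : φ ∈ IsManifold.maximalAtlas (𝓡 2) ∞ M) {y : Plane} (hy : y ∈ φ.target) :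
    ∃ e : Plane ≃ₗᵢ[ℝ] TangentSpace (𝓡 2) (φ.symm y),
      ∀ v : Plane, mfderiv (𝓡 2) (𝓡 2) φ.symm y v = e (Real.exp (ρ y) • v) := by
  obtain ⟨L, hL⟩ := exists_chartEquiv hφ hy
  have hexp := Real.exp_ne_zero (-ρ y)
  let e : Plane ≃ₗᵢ[ℝ] TangentSpace (𝓡 2) (φ.symm y) :=
    ((LinearEquiv.smulOfNeZero ℝ Plane _ hexp).trans L.toLinearEquiv).isometryOfInner
      fun v w => by
        have h := hρ.inner_mfderiv hy (Real.exp (-ρ y) • v) (Real.exp (-ρ y) • w)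
        rw [hL, hL] at h
        refine h.trans ?_
        rw [real_inner_smul_left, real_inner_smul_right, ← mul_assoc, ← mul_assoc, ← Real.exp_add,
          ← Real.exp_add]
        ring_nf
        simp
  refine ⟨e, fun v => ?_⟩
  have h : e (Real.exp (ρ y) • v) = L (Real.exp (-ρ y) • Real.exp (ρ y) • v) := rfl
  rw [h, smul_smul, ← Real.exp_add, neg_add_cancel, Real.exp_zero, one_smul, hL]

/-- The trace of a vector-valued bilinear map is the same in all orthonormal bases. The unspecified
basis of the tangent space may therefore be replaced by the coordinate basis, at the cost of a
nonzero power of `e^ρ`. -/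
lemma HasConformalFactor.divTensor_eq_zero_iff (hρ : HasConformalFactor φ ρ)
    (hφ : φ ∈ IsManifold.maximalAtlas (𝓡 2) ∞ M) (hρd : ContDiffOn ℝ ∞ ρ φ.target)
    (hT : IsSmoothTensor T) (hs : IsSymmetricTensor T) {y : Plane} (hy : y ∈ φ.target) :
    divTensor T (φ.symm y) = 0 ↔ DivEq ρ (tensorRep φ T) y := by
  obtain ⟨e, he⟩ := hρ.exists_isometry hφ hy
  set A := tensorRep φ T
  have hexp := Real.exp_ne_zero (ρ y)
  have h1 (v : TangentSpace (𝓡 2) (φ.symm y)) :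
      nablaTensor T (extendVec v) (extendVec v) (φ.symm y) =
        e ((Real.exp (ρ y))⁻¹ • conformalNablaₗ ρ A y (e.symm v) (e.symm v)) := by
    have hv : localRep φ (extendVec v) y = (Real.exp (ρ y))⁻¹ • e.symm v := by
      rw [localRep_eq_iff hφ hy, he, smul_inv_smul₀ hexp, e.apply_symm_apply, extendVec_self]
    have h2 := hρ.nablaTensor_eq hφ hρd hT hy (fieldDiffAt_extendVec v) (fieldDiffAt_extendVec v)
    rw [hv, localRep_eq_iff hφ hy, he] at h2
    have h3 : conformalNabla ρ A y ((Real.exp (ρ y))⁻¹ • e.symm v)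
        ((Real.exp (ρ y))⁻¹ • e.symm v) = conformalNablaₗ ρ A y ((Real.exp (ρ y))⁻¹ • e.symm v)
        ((Real.exp (ρ y))⁻¹ • e.symm v) := rfl
    rw [h2, h3, (conformalNablaₗ ρ A y _).map_smul, LinearMap.map_smul₂, smul_inv_smul₀ hexp]
  have h2 : divTensor T (φ.symm y) = e ((Real.exp (ρ y))⁻¹ •
      ∑ i, conformalNablaₗ ρ A y ((stdOrthonormalBasis ℝ _).map e.symm i)
        ((stdOrthonormalBasis ℝ _).map e.symm i)) := by
    rw [divTensor, Finset.smul_sum, map_sum]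
    exact Finset.sum_congr rfl fun i _ => h1 _
  rw [h2, map_eq_zero_iff e e.injective, smul_eq_zero_iff_right (inv_ne_zero hexp),
    OrthonormalBasis.sum_bilin_eq _ (EuclideanSpace.basisFun (Fin 2) ℝ),
    ← sum_conformalNabla_eq_zero_iff (hT.differentiableAt hφ hy)
      (hρ.entry_symm_eventually hφ hs hy)]
  simp only [EuclideanSpace.basisFun_apply]
  rfl

end Conditions

end RiemSurf

end

/-! ### Convolution equations in weighted `ℓ¹` spaces. -/

noncomputable section

namespace RiemSurf

open Set Filter Topology

section Convolution

open scoped ENNReal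

variable {G : Type*} [AddCommGroup G]

/-- The weighted `ℓ¹` norm of a family of complex numbers. -/
def wnorm (W : G → ℝ≥0∞) (c : G → ℂ) : ℝ≥0∞ := ∑' n, W n * ‖c n‖ₑ

/-- The convolution of two families of complex numbers. -/
def conv (a d : G → ℂ) (n : G) : ℂ := ∑' m, a (n - m) * d m

/-- Submultiplicativity splits the weight as `W n ≤ W (n - m) * W m`, and Tonelli exchanges the
sums. Values in `[0, ∞]` make summability hypotheses unnecessary. -/
lemma wnorm_conv_le {W : G → ℝ≥0∞} (hW : ∀ n m, W (n + m) ≤ W n * W m) (a d : G → ℂ) :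
    wnorm W (conv a d) ≤ wnorm W a * wnorm W d := by
  calc wnorm W (conv a d) ≤ ∑' n, ∑' m, (W (n - m) * ‖a (n - m)‖ₑ) * (W m * ‖d m‖ₑ) := by
        refine ENNReal.tsum_le_tsum fun n => ?_
        refine (mul_le_mul_right enorm_tsum_le_tsum_enorm _).trans ?_
        rw [← ENNReal.tsum_mul_left]
        refine ENNReal.tsum_le_tsum fun m => ?_
        have h := hW (n - m) m
        rw [sub_add_cancel] at h
        rw [enorm_mul]
        refine (mul_le_mul_left h _).trans (le_of_eq ?_)
        ring
    _ = ∑' m, ∑' n, (W (n - m) * ‖a (n - m)‖ₑ) * (W m * ‖d m‖ₑ) := ENNReal.tsum_comm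
    _ = ∑' m, wnorm W a * (W m * ‖d m‖ₑ) := by
        refine tsum_congr fun m => ?_
        rw [ENNReal.tsum_mul_right]
        congr 1
        exact (Equiv.subRight m).tsum_eq fun n => W n * ‖a n‖ₑ
    _ = wnorm W a * wnorm W d := ENNReal.tsum_mul_left

/-- The terms of the Neumann series for the equation `s = b + S (a * s)`. -/
def neumannTerm (S a b : G → ℂ) : ℕ → G → ℂ
  | 0 => b
  | k + 1 => fun n => S n * conv a (neumannTerm S a b k) n

lemma wnorm_neumannTerm_le {W : G → ℝ≥0∞} (hW : ∀ n m, W (n + m) ≤ W n * W m) {S : G → ℂ}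
    (hS : ∀ n, ‖S n‖ ≤ 1) (a b : G → ℂ) (k : ℕ) :
    wnorm W (neumannTerm S a b k) ≤ wnorm W a ^ k * wnorm W b := by
  induction k with
  | zero => simp [neumannTerm]
  | succ k ih =>
    have h1 : wnorm W (neumannTerm S a b (k + 1)) ≤ wnorm W (conv a (neumannTerm S a b k)) := by
      refine ENNReal.tsum_le_tsum fun n => mul_le_mul_right ?_ _
      rw [neumannTerm, enorm_mul]
      have : ‖S n‖ₑ ≤ 1 := by
        rw [← ofReal_norm]; exact ENNReal.ofReal_le_one.2 (hS n)
      exact mul_le_of_le_one_left zero_le this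
    calc _ ≤ wnorm W a * (wnorm W a ^ k * wnorm W b) :=
          h1.trans ((wnorm_conv_le hW _ _).trans (mul_le_mul_right ih _))
      _ = wnorm W a ^ (k + 1) * wnorm W b := by ring

/-- The equation `s = b + S (a * s)` has a solution, with control of all submultiplicative
weighted `ℓ¹` norms. -/
theorem exists_eq_add_mul_conv {S a b : G → ℂ} (hS : ∀ n, ‖S n‖ ≤ 1)
    (ha : wnorm (fun _ => 1) a < 1) (hb : wnorm (fun _ => 1) b ≠ ⊤) :
    ∃ s : G → ℂ, (∀ n, s n = b n + S n * conv a s n) ∧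
      ∀ W : G → ℝ≥0∞, (∀ n m, W (n + m) ≤ W n * W m) →
        wnorm W s ≤ (1 - wnorm W a)⁻¹ * wnorm W b := by
  set d := neumannTerm S a b with hd
  -- The geometric series is summed in `[0, ∞]`, so nothing is assumed about the size of `wnorm W
  -- a`. One solution therefore serves for all weights at once.
  have hsum (W : G → ℝ≥0∞) (hW : ∀ n m, W (n + m) ≤ W n * W m) :
      ∑' n, ∑' k, W n * ‖d k n‖ₑ ≤ (1 - wnorm W a)⁻¹ * wnorm W b := by
    rw [ENNReal.tsum_comm, ← ENNReal.tsum_geometric, ← ENNReal.tsum_mul_right]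
    exact ENNReal.tsum_le_tsum fun k => wnorm_neumannTerm_le hW hS a b k
  have hfin : ∑' n, ∑' k, ‖d k n‖ₑ ≠ ⊤ := by
    have h := hsum (fun _ => 1) (fun _ _ => by simp)
    simp only [one_mul] at h
    refine ne_top_of_le_ne_top (ENNReal.mul_ne_top ?_ hb) h
    exact ENNReal.inv_ne_top.2 (tsub_pos_of_lt ha).ne'
  have hsk (n : G) : Summable fun k => d k n :=
    (tsum_enorm_ne_top_iff_summable_norm.1 (ENNReal.ne_top_of_tsum_ne_top hfin n)).of_norm
  refine ⟨fun n => ∑' k, d k n, fun n => ?_, fun W hW => ?_⟩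
  · have h1 : Summable (Function.uncurry fun (k : ℕ) (m : G) => a (n - m) * d k m) := by
      refine (tsum_enorm_ne_top_iff_summable_norm.1 ?_).of_norm
      rw [ENNReal.tsum_prod', ENNReal.tsum_comm]
      simp only [Function.uncurry_apply_pair, enorm_mul, ENNReal.tsum_mul_left]
      have ha' (m : G) : ‖a (n - m)‖ₑ ≤ 1 := by
        refine le_trans ?_ ha.le
        simpa [wnorm] using ENNReal.le_tsum (f := fun n => ‖a n‖ₑ) (n - m)
      refine ne_top_of_le_ne_top hfin (ENNReal.tsum_le_tsum fun m => ?_)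
      exact mul_le_of_le_one_left zero_le (ha' m)
    have h2 : conv a (fun n => ∑' k, d k n) n = ∑' k, conv a (d k) n := by
      simp only [conv, ← tsum_mul_left]
      exact h1.tsum_comm
    beta_reduce
    rw [h2, (hsk n).tsum_eq_zero_add, ← tsum_mul_left]
    rfl
  · refine le_trans (ENNReal.tsum_le_tsum fun n => ?_) (hsum W hW)
    rw [ENNReal.tsum_mul_left]
    exact mul_le_mul_right enorm_tsum_le_tsum_enorm _

end Convolution

/-! ### Rapidly decaying solutions. -/

section RapidDecay

/-- The lattice of frequencies of doubly periodic functions. -/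
abbrev Freq : Type := Fin 2 → ℤ

/-- A family of complex numbers decays faster than all powers of the frequency. -/
def RapidDecay (c : Freq → ℂ) : Prop := ∀ k : ℕ, Summable fun n => (1 + ‖n‖) ^ k * ‖c n‖

lemma RapidDecay.summable_norm {c : Freq → ℂ} (hc : RapidDecay c) : Summable fun n => ‖c n‖ := by
  simpa using hc 0

lemma RapidDecay.of_norm_le {c c' : Freq → ℂ} (hc : RapidDecay c) (h : ∀ n, ‖c' n‖ ≤ ‖c n‖) :
    RapidDecay c' := fun k =>
  (hc k).of_nonneg_of_le (fun n => by positivity) fun n => by gcongr; exact h n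

lemma RapidDecay.add {c c' : Freq → ℂ} (hc : RapidDecay c) (hc' : RapidDecay c') :
    RapidDecay (c + c') := fun k =>
  ((hc k).add (hc' k)).of_nonneg_of_le (fun n => by positivity) fun n => by
    rw [← mul_add]; gcongr; exact norm_add_le _ _

lemma rapidDecay_single (n₀ : Freq) (z : ℂ) : RapidDecay (Pi.single n₀ z) := fun k =>
  summable_of_ne_finset_zero (s := {n₀}) fun n hn => by
    rw [Pi.single_eq_of_ne (by simpa using hn)]; simp

/-- The weights `(1 + ε ‖n‖) ^ k`. -/
def weight (ε : ℝ) (k : ℕ) (n : Freq) : ENNReal := ENNReal.ofReal ((1 + ε * ‖n‖) ^ k)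

lemma weight_add_le {ε : ℝ} (hε : 0 ≤ ε) (k : ℕ) (n m : Freq) :
    weight ε k (n + m) ≤ weight ε k n * weight ε k m := by
  rw [weight, weight, weight, ← ENNReal.ofReal_mul (by positivity), ← mul_pow]
  refine ENNReal.ofReal_le_ofReal (pow_le_pow_left₀ (by positivity) ?_ k)
  have h := norm_add_le n m
  nlinarith [mul_nonneg (mul_nonneg hε (norm_nonneg n)) (mul_nonneg hε (norm_nonneg m)),
    mul_le_mul_of_nonneg_left h hε]

lemma wnorm_weight {ε : ℝ} (hε : 0 ≤ ε) {k : ℕ} {c : Freq → ℂ}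
    (h : Summable fun n => (1 + ε * ‖n‖) ^ k * ‖c n‖) :
    wnorm (weight ε k) c = ENNReal.ofReal (∑' n, (1 + ε * ‖n‖) ^ k * ‖c n‖) := by
  rw [ENNReal.ofReal_tsum_of_nonneg (fun n => by positivity) h]
  refine tsum_congr fun n => ?_
  rw [ENNReal.ofReal_mul (by positivity), ofReal_norm, weight]

lemma summable_of_wnorm_ne_top {ε : ℝ} (hε : 0 ≤ ε) {k : ℕ} {c : Freq → ℂ}
    (h : wnorm (weight ε k) c ≠ ⊤) : Summable fun n => (1 + ε * ‖n‖) ^ k * ‖c n‖ := by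
  have h1 : ∑' n, ‖(((1 + ε * ‖n‖) ^ k : ℝ) : ℂ) * c n‖ₑ ≠ ⊤ := by
    convert h using 2
    refine tsum_congr fun n => ?_
    rw [enorm_mul, weight, ← ofReal_norm, Complex.norm_real, Real.norm_of_nonneg (by positivity)]
  refine (tsum_enorm_ne_top_iff_summable_norm.1 h1).congr fun n => ?_
  rw [norm_mul, Complex.norm_real, Real.norm_of_nonneg (by positivity)]

lemma RapidDecay.conv {a c : Freq → ℂ} (ha : RapidDecay a) (hc : RapidDecay c) :
    RapidDecay (RiemSurf.conv a c) := fun k => by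
  have h (c : Freq → ℂ) (hc : RapidDecay c) : wnorm (weight 1 k) c ≠ ⊤ := by
    rw [wnorm_weight zero_le_one (by simpa using hc k)]
    exact ENNReal.ofReal_ne_top
  simpa using summable_of_wnorm_ne_top zero_le_one (ne_top_of_le_ne_top
    (ENNReal.mul_ne_top (h a ha) (h c hc)) (wnorm_conv_le (weight_add_le zero_le_one k) a c))

lemma wnorm_one {c : Freq → ℂ} (h : Summable fun n => ‖c n‖) :
    wnorm (fun _ => 1) c = ENNReal.ofReal (∑' n, ‖c n‖) := by
  rw [ENNReal.ofReal_tsum_of_nonneg (fun n => norm_nonneg _) h]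
  simp [wnorm, ofReal_norm]

lemma RapidDecay.summable_weight {c : Freq → ℂ} (hc : RapidDecay c) {ε : ℝ} (hε : 0 ≤ ε)
    (hε1 : ε ≤ 1) (k : ℕ) : Summable fun n => (1 + ε * ‖n‖) ^ k * ‖c n‖ :=
  (hc k).of_nonneg_of_le (fun n => by positivity) fun n => by
    gcongr; exact mul_le_of_le_one_left (norm_nonneg n) hε1

/-- As `ε → 0` the weighted norm tends to the plain `ℓ¹` norm by dominated convergence. A
contraction in `ℓ¹` is thus a contraction for some weight of every order `k`, and regularity of the
solution needs no further smallness. -/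
lemma RapidDecay.exists_wnorm_lt_one {a : Freq → ℂ} (ha : RapidDecay a) (h : ∑' n, ‖a n‖ < 1)
    (k : ℕ) : ∃ ε : ℝ, 0 < ε ∧ ε ≤ 1 ∧ wnorm (weight ε k) a < 1 := by
  have ht : Tendsto (fun ε : ℝ => ∑' n, (1 + ε * ‖n‖) ^ k * ‖a n‖) (𝓝[Ioc 0 1] 0)
      (𝓝 (∑' n, ‖a n‖)) := by
    refine tendsto_tsum_of_dominated_convergence (ha k) (fun n => ?_) ?_
    · have : ContinuousAt (fun ε : ℝ => (1 + ε * ‖n‖) ^ k * ‖a n‖) 0 := by fun_prop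
      simpa using this.tendsto.mono_left nhdsWithin_le_nhds
    · filter_upwards [self_mem_nhdsWithin] with ε hε n
      have := hε.1
      rw [Real.norm_of_nonneg (by positivity)]
      gcongr
      exact mul_le_of_le_one_left (norm_nonneg n) hε.2
  have hne : (𝓝[Ioc (0 : ℝ) 1] 0).NeBot := by
    rw [nhdsWithin_Ioc_eq_nhdsGT one_pos]; infer_instance
  obtain ⟨ε, h1, hε⟩ := ((ht.eventually (gt_mem_nhds h)).and self_mem_nhdsWithin).exists
  refine ⟨ε, hε.1, hε.2, ?_⟩
  rw [wnorm_weight hε.1.le (ha.summable_weight hε.1.le hε.2 k)]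
  exact ENNReal.ofReal_lt_one.2 h1

/-- The equation `s = b + S (a * s)` with rapidly decaying data has a rapidly decaying solution. -/
theorem RapidDecay.exists_eq_add_mul_conv {S a b : Freq → ℂ} (hS : ∀ n, ‖S n‖ ≤ 1)
    (ha : RapidDecay a) (hb : RapidDecay b) (ha1 : ∑' n, ‖a n‖ < 1) :
    ∃ s : Freq → ℂ, RapidDecay s ∧ (∀ n, s n = b n + S n * RiemSurf.conv a s n) ∧
      ∑' n, ‖s n‖ ≤ (∑' n, ‖b n‖) / (1 - ∑' n, ‖a n‖) := by
  have hwa := wnorm_one ha.summable_norm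
  have hwb := wnorm_one hb.summable_norm
  obtain ⟨s, hs, hsW⟩ := RiemSurf.exists_eq_add_mul_conv (S := S) (a := a) (b := b) hS
    (by rw [hwa]; exact ENNReal.ofReal_lt_one.2 ha1) (by rw [hwb]; exact ENNReal.ofReal_ne_top)
  have hdecay : RapidDecay s := by
    intro k
    obtain ⟨ε, hε, hε1, hlt⟩ := ha.exists_wnorm_lt_one ha1 k
    have h1 : wnorm (weight ε k) s ≠ ⊤ := by
      refine ne_top_of_le_ne_top (ENNReal.mul_ne_top ?_ ?_) (hsW _ (weight_add_le hε.le k))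
      · exact ENNReal.inv_ne_top.2 (tsub_pos_of_lt hlt).ne'
      · rw [wnorm_weight hε.le (hb.summable_weight hε.le hε1 k)]
        exact ENNReal.ofReal_ne_top
    have h2 := summable_of_wnorm_ne_top hε.le h1
    refine (h2.mul_left ((ε⁻¹) ^ k)).of_nonneg_of_le (fun n => by positivity) fun n => ?_
    rw [← mul_assoc, ← mul_pow]
    gcongr
    rw [mul_add, mul_one, inv_mul_cancel_left₀ hε.ne']
    gcongr
    exact one_le_inv_iff₀.2 ⟨hε, hε1⟩
  refine ⟨s, hdecay, hs, ?_⟩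
  have h := hsW (fun _ => 1) (fun _ _ => by simp)
  have hpos : 0 < 1 - ∑' n, ‖a n‖ := by linarith
  rw [wnorm_one hdecay.summable_norm, hwa, hwb, ← ENNReal.ofReal_one,
    ← ENNReal.ofReal_sub _ (tsum_nonneg fun _ => norm_nonneg _), ← ENNReal.ofReal_inv_of_pos hpos,
    ← ENNReal.ofReal_mul (inv_nonneg.2 hpos.le), ENNReal.ofReal_le_ofReal_iff
    (mul_nonneg (inv_nonneg.2 hpos.le) (tsum_nonneg fun _ => norm_nonneg _))] at h
  rwa [div_eq_inv_mul]

end RapidDecay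

end RiemSurf

end

/-! ### Doubly periodic functions given by Fourier series. -/

noncomputable section

namespace RiemSurf

open Set Filter Topology

section Series

/-- The linear form `x ↦ 2πi ⟨n, x⟩`. -/
def phase (n : Freq) : Plane →L[ℝ] ℂ :=
  ∑ i, (EuclideanSpace.proj i : Plane →L[ℝ] ℝ).smulRight (2 * Real.pi * Complex.I * n i : ℂ)

lemma phase_apply (n : Freq) (x : Plane) :
    phase n x = 2 * Real.pi * Complex.I * n 0 * x 0 + 2 * Real.pi * Complex.I * n 1 * x 1 := by
  simp [phase]
  ring

lemma phase_add (n m : Freq) (x : Plane) : phase (n + m) x = phase n x + phase m x := by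
  simp only [phase_apply, Pi.add_apply]
  push_cast
  ring

/-- The function `x ↦ e^{2πi ⟨n, x⟩}`. -/
def char (n : Freq) (x : Plane) : ℂ := Complex.exp (phase n x)

lemma norm_char (n : Freq) (x : Plane) : ‖char n x‖ = 1 := by
  have : phase n x = ((2 * Real.pi * n 0 * x 0 + 2 * Real.pi * n 1 * x 1 : ℝ) : ℂ) * Complex.I := by
    rw [phase_apply]; push_cast; ring
  rw [char, this, Complex.norm_exp_ofReal_mul_I]

lemma char_add (n m : Freq) (x : Plane) : char (n + m) x = char n x * char m x := by
  rw [char, phase_add, Complex.exp_add]; rfl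

lemma char_zero (x : Plane) : char 0 x = 1 := by
  simp [char, phase_apply]

lemma hasFDerivAt_char (n : Freq) (x : Plane) :
    HasFDerivAt (char n) (char n x • phase n) x :=
  (phase n).hasFDerivAt.cexp

/-- The doubly periodic function with Fourier coefficients `c`. -/
def series (c : Freq → ℂ) (x : Plane) : ℂ := ∑' n, c n * char n x

/-- The Fourier coefficients of the partial derivatives. -/
def dcoef (i : Fin 2) (c : Freq → ℂ) (n : Freq) : ℂ := 2 * Real.pi * Complex.I * n i * c n

lemma RapidDecay.dcoef {c : Freq → ℂ} (hc : RapidDecay c) (i : Fin 2) :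
    RapidDecay (dcoef i c) := fun k => by
  refine ((hc (k + 1)).mul_left (2 * Real.pi)).of_nonneg_of_le (fun n => by positivity) fun n => ?_
  have h1 : ‖RiemSurf.dcoef i c n‖ ≤ 2 * Real.pi * (1 + ‖n‖) * ‖c n‖ := by
    have h2 : ‖(n i : ℂ)‖ ≤ 1 + ‖n‖ := by
      have := norm_le_pi_norm n i
      rw [Complex.norm_intCast, ← Int.norm_eq_abs]
      linarith
    rw [RiemSurf.dcoef, norm_mul, norm_mul]
    simp only [norm_mul, Complex.norm_I, Complex.norm_real, mul_one, Complex.norm_ofNat,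
      Real.norm_of_nonneg Real.pi_pos.le]
    gcongr
  calc _ ≤ (1 + ‖n‖) ^ k * (2 * Real.pi * (1 + ‖n‖) * ‖c n‖) := by gcongr
    _ = _ := by ring

lemma RapidDecay.summable {c : Freq → ℂ} (hc : RapidDecay c) (x : Plane) :
    Summable fun n => c n * char n x := by
  refine Summable.of_norm ?_
  simpa [norm_char] using hc.summable_norm

/-- The linear form `v ↦ v i * z` on the plane. -/
def coordMul (i : Fin 2) : ℂ →L[ℝ] Plane →L[ℝ] ℂ :=
  ContinuousLinearMap.smulRightL ℝ Plane ℂ (EuclideanSpace.proj i)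

lemma coordMul_apply (i : Fin 2) (z : ℂ) (v : Plane) : coordMul i z v = v i * z := by
  simp [coordMul]

lemma RapidDecay.hasFDerivAt_series {c : Freq → ℂ} (hc : RapidDecay c) (x : Plane) :
    HasFDerivAt (series c) (coordMul 0 (series (RiemSurf.dcoef 0 c) x) +
      coordMul 1 (series (RiemSurf.dcoef 1 c) x)) x := by
  have hterm (n : Freq) (x : Plane) : c n • (char n x • phase n) =
      coordMul 0 (RiemSurf.dcoef 0 c n * char n x) +
        coordMul 1 (RiemSurf.dcoef 1 c n * char n x) := by
    refine ContinuousLinearMap.ext fun v => ?_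
    simp [coordMul_apply, phase_apply, RiemSurf.dcoef]
    ring
  have hnP (i : Fin 2) (n : Freq) (x : Plane) : ‖coordMul i (RiemSurf.dcoef i c n * char n x)‖ ≤
      ‖coordMul i‖ * ‖RiemSurf.dcoef i c n‖ := by
    refine ((coordMul i).le_opNorm _).trans_eq ?_
    rw [norm_mul, norm_char, mul_one]
  have h := hasFDerivAt_tsum (f := fun n x => c n * char n x)
    (((hc.dcoef 0).summable_norm.mul_left ‖coordMul 0‖).add
      ((hc.dcoef 1).summable_norm.mul_left ‖coordMul 1‖))
    (fun n x => (hasFDerivAt_char n x).const_mul (c n))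
    (fun n x => by
      rw [hterm]
      exact (norm_add_le _ _).trans (add_le_add (hnP 0 n x) (hnP 1 n x)))
    (x₀ := x) (hc.summable x) x
  refine h.congr_fderiv ?_
  simp only [hterm]
  rw [((coordMul 0).summable ((hc.dcoef 0).summable x)).tsum_add
    ((coordMul 1).summable ((hc.dcoef 1).summable x)),
    ← (coordMul 0).map_tsum ((hc.dcoef 0).summable x),
    ← (coordMul 1).map_tsum ((hc.dcoef 1).summable x)]
  rfl

/-- The derivative is assembled from series whose coefficients again decay rapidly, so induction on
the order runs over all such families. -/
lemma RapidDecay.contDiff_series {c : Freq → ℂ} (hc : RapidDecay c) :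
    ContDiff ℝ ∞ (series c) := by
  refine contDiff_infty.2 fun k => ?_
  induction k generalizing c with
  | zero =>
    exact contDiff_zero.2 (continuous_iff_continuousAt.2 fun x =>
      (hc.hasFDerivAt_series x).continuousAt)
  | succ k ih =>
    push_cast
    rw [contDiff_succ_iff_hasFDerivAt]
    refine ⟨fun x => coordMul 0 (series (RiemSurf.dcoef 0 c) x) +
      coordMul 1 (series (RiemSurf.dcoef 1 c) x), ?_, hc.hasFDerivAt_series⟩
    have h (i : Fin 2) : ContDiff ℝ k fun x => coordMul i (series (RiemSurf.dcoef i c) x) :=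
      (coordMul i).contDiff.comp (ih (hc.dcoef i))
    exact (h 0).add (h 1)

lemma tsum_mul_tsum_eq_tsum_conv {G : Type*} [AddCommGroup G] {χ : G → ℂ}
    (hχ : ∀ n m, χ (n + m) = χ n * χ m) {a c : G → ℂ} (ha : Summable fun n => ‖a n * χ n‖)
    (hc : Summable fun n => ‖c n * χ n‖) :
    (∑' n, a n * χ n) * (∑' n, c n * χ n) = ∑' n, conv a c n * χ n := by
  let f : G → ℂ := fun n => a n * χ n
  let g : G → ℂ := fun n => c n * χ n
  let F : G × G → ℂ := fun p => f p.1 * g p.2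
  have h1 : Summable F := summable_mul_of_summable_norm (f := f) (g := g) ha hc
  -- The shear `(n, m) ↦ (n - m, m)` turns the double sum of the product into a sum of convolutions.
  let e : G × G ≃ G × G :=
    { toFun := fun p => (p.1 - p.2, p.2)
      invFun := fun p => (p.1 + p.2, p.2)
      left_inv := fun p => by simp
      right_inv := fun p => by simp }
  have h2 : Summable (F ∘ e) := e.summable_iff.2 h1
  have h3 : ∑' p, (F ∘ e) p = ∑' p, F p := e.tsum_eq F
  refine (tsum_mul_tsum_of_summable_norm (f := f) (g := g) ha hc).trans ?_
  refine h3.symm.trans (h2.tsum_prod.trans (tsum_congr fun n => ?_))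
  rw [conv, ← tsum_mul_right]
  refine tsum_congr fun m => ?_
  have h4 : χ n = χ (n - m) * χ m := by rw [← hχ, sub_add_cancel]
  rw [h4]
  simp only [Function.comp_apply, F, f, g, e, Equiv.coe_fn_mk]
  ring

lemma RapidDecay.series_mul {a c : Freq → ℂ} (ha : RapidDecay a) (hc : RapidDecay c) (x : Plane) :
    series a x * series c x = series (RiemSurf.conv a c) x :=
  tsum_mul_tsum_eq_tsum_conv (χ := fun n => char n x) (fun n m => char_add n m x)
    (by simpa [norm_char] using ha.summable_norm) (by simpa [norm_char] using hc.summable_norm)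

lemma RapidDecay.series_add {a c : Freq → ℂ} (ha : RapidDecay a) (hc : RapidDecay c) (x : Plane) :
    series (a + c) x = series a x + series c x := by
  rw [series, series, series, ← (ha.summable x).tsum_add (hc.summable x)]
  simp [add_mul]

lemma series_single_zero (z : ℂ) (x : Plane) : series (Pi.single 0 z) x = z := by
  rw [series, tsum_eq_single 0 fun n hn => by rw [Pi.single_eq_of_ne hn, zero_mul]]
  simp [char_zero]

lemma RapidDecay.norm_series_le {c : Freq → ℂ} (hc : RapidDecay c) (x : Plane) :
    ‖series c x‖ ≤ ∑' n, ‖c n‖ := by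
  have h : Summable fun n => ‖c n * char n x‖ := by simpa [norm_char] using hc.summable_norm
  simpa [series, norm_char] using norm_tsum_le_tsum_norm h

end Series

/-! ### The periodic Beltrami equation. -/

section Wirtinger

/-- The derivative `∂f/∂z`. -/
def wirt (f : Plane → ℂ) (x : Plane) : ℂ :=
  (fderiv ℝ f x (unitVec 0) - Complex.I * fderiv ℝ f x (unitVec 1)) / 2

/-- The derivative `∂f/∂z̄`. -/
def wirtBar (f : Plane → ℂ) (x : Plane) : ℂ :=
  (fderiv ℝ f x (unitVec 0) + Complex.I * fderiv ℝ f x (unitVec 1)) / 2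

/-- The Beltrami equation with a doubly periodic coefficient of small oscillation. -/
theorem exists_beltrami_periodic {c : Freq → ℂ} (hc : RapidDecay c) {μ₀ : ℂ}
    (h : ‖μ₀‖ + 2 * ∑' n, ‖c n‖ < 1) :
    ∃ f : Plane → ℂ, ContDiff ℝ ∞ f ∧ (∀ x, wirt f x ≠ 0) ∧
      ∀ x, wirtBar f x = (μ₀ + series c x) * wirt f x := by
  -- `σ` and `τ` are the symbols of `∂/∂z̄` and `∂/∂z` on `char n`. The solution is sought with `f_z
  -- = 1 + s` and `f_z̄ = w`, so that the Beltrami equation reads `w = a + a * s`, and equality of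
  -- mixed derivatives reads `s = S w` with `S = τ / σ`. Here `|S| = 1` off the zero frequency, and
  -- `S 0 = 0` because division by zero gives zero.
  let σ (n : Freq) : ℂ := Real.pi * Complex.I * (n 0 + Complex.I * n 1)
  let τ (n : Freq) : ℂ := Real.pi * Complex.I * (n 0 - Complex.I * n 1)
  let S (n : Freq) : ℂ := τ n / σ n
  let a : Freq → ℂ := Pi.single 0 μ₀ + c
  have ha : RapidDecay a := (rapidDecay_single 0 μ₀).add hc
  have hσ0 : σ 0 = 0 := by simp [σ]
  have hnσ (n : Freq) : ‖σ n‖ ^ 2 = Real.pi ^ 2 * ((n 0 : ℝ) ^ 2 + (n 1 : ℝ) ^ 2) := by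
    simp only [σ, norm_mul, Complex.norm_I, Complex.norm_real, mul_one, mul_pow,
      Complex.sq_norm, Complex.normSq_apply, Real.norm_eq_abs, sq_abs]
    simp
    ring
  have hnτ (n : Freq) : ‖τ n‖ ^ 2 = Real.pi ^ 2 * ((n 0 : ℝ) ^ 2 + (n 1 : ℝ) ^ 2) := by
    simp only [τ, norm_mul, Complex.norm_I, Complex.norm_real, mul_one, mul_pow,
      Complex.sq_norm, Complex.normSq_apply, Real.norm_eq_abs, sq_abs]
    simp
    ring
  have hσ1 (n : Freq) (hn : n ≠ 0) : 1 ≤ ‖σ n‖ := by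
    have h1 : (1 : ℝ) ≤ (n 0 : ℝ) ^ 2 + (n 1 : ℝ) ^ 2 := by
      have h2 : n 0 ≠ 0 ∨ n 1 ≠ 0 := by
        by_contra! h3
        exact hn (by ext i; fin_cases i <;> simp [h3])
      have h3 : (1 : ℤ) ≤ n 0 ^ 2 + n 1 ^ 2 := by
        rcases h2 with h2 | h2
        · nlinarith [sq_nonneg (n 1), Int.one_le_abs h2, sq_abs (n 0)]
        · nlinarith [sq_nonneg (n 0), Int.one_le_abs h2, sq_abs (n 1)]
      exact_mod_cast h3
    have h2 : 1 ≤ ‖σ n‖ ^ 2 := by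
      rw [hnσ]
      nlinarith [Real.pi_gt_three]
    nlinarith [norm_nonneg (σ n)]
  have hσn (n : Freq) (hn : n ≠ 0) : σ n ≠ 0 := norm_pos_iff.1 (one_pos.trans_le (hσ1 n hn))
  have hS (n : Freq) : ‖S n‖ ≤ 1 := by
    have h1 : ‖τ n‖ = ‖σ n‖ := by
      rw [← sq_eq_sq₀ (norm_nonneg _) (norm_nonneg _), hnσ, hnτ]
    simp only [S, norm_div, h1]
    exact div_self_le_one _
  have hS0 : S 0 = 0 := by simp [S, hσ0]
  -- Since `S 0 = 0`, the constant `μ₀` drops out of the inhomogeneous term `S a = S c`. Hence `s`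
  -- is small with `c`, however close `|μ₀|` is to one.
  let b : Freq → ℂ := fun n => S n * c n
  have hSc (n : Freq) : ‖b n‖ ≤ ‖c n‖ := by
    rw [norm_mul]; exact mul_le_of_le_one_left (norm_nonneg _) (hS n)
  have hb : RapidDecay b := hc.of_norm_le hSc
  have hba (n : Freq) : b n = S n * a n := by
    rcases eq_or_ne n 0 with rfl | hn
    · simp [b, hS0]
    · simp [b, a, hn]
  have hbc : ∑' n, ‖b n‖ ≤ ∑' n, ‖c n‖ := hb.summable_norm.tsum_le_tsum hSc hc.summable_norm
  have hanorm : ∑' n, ‖a n‖ ≤ ‖μ₀‖ + ∑' n, ‖c n‖ := by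
    have hs := (rapidDecay_single 0 μ₀).summable_norm
    have h1 : ∑' n : Freq, ‖(Pi.single 0 μ₀ : Freq → ℂ) n‖ = ‖μ₀‖ := by
      rw [tsum_eq_single 0 fun n hn => by rw [Pi.single_eq_of_ne hn, norm_zero]]
      simp
    rw [← h1, ← hs.tsum_add hc.summable_norm]
    exact ha.summable_norm.tsum_le_tsum (fun n => norm_add_le _ _) (hs.add hc.summable_norm)
  have hc0 : 0 ≤ ∑' n, ‖c n‖ := tsum_nonneg fun _ => norm_nonneg _
  obtain ⟨s, hs, hseq, hsn⟩ := RapidDecay.exists_eq_add_mul_conv hS ha hb (by linarith)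
  have hs1 : ∑' n, ‖s n‖ < 1 := by
    refine hsn.trans_lt ?_
    -- The bound `‖c‖ / (1 - |μ₀| - ‖c‖) < 1` in `ℓ¹` norms is exactly the hypothesis.
    rw [div_lt_one (by linarith)]
    linarith
  let w : Freq → ℂ := a + conv a s
  have hw : RapidDecay w := ha.add (ha.conv hs)
  let g : Freq → ℂ := fun n => w n / σ n
  have hg : RapidDecay g := hw.of_norm_le fun n => by
    rcases eq_or_ne n 0 with rfl | hn
    · simp [g, hσ0]
    · rw [norm_div]; exact div_le_self (norm_nonneg _) (hσ1 n hn)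
  -- This is `z + w₀ z̄`. It supplies the mean values of the derivatives, which no periodic function
  -- can.
  let L : Plane →L[ℝ] ℂ := coordMul 0 (1 + w 0) + coordMul 1 (Complex.I - Complex.I * w 0)
  have hf (x : Plane) : HasFDerivAt (fun x => L x + series g x) _ x :=
    L.hasFDerivAt.add (hg.hasFDerivAt_series x)
  have hd0 (x : Plane) : fderiv ℝ (fun x => L x + series g x) x (unitVec 0) =
      1 + w 0 + series (dcoef 0 g) x := by
    rw [(hf x).fderiv]; simp [L, coordMul_apply]
  have hd1 (x : Plane) : fderiv ℝ (fun x => L x + series g x) x (unitVec 1) =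
      Complex.I - Complex.I * w 0 + series (dcoef 1 g) x := by
    rw [(hf x).fderiv]; simp [L, coordMul_apply]
  have hs0 : s 0 = 0 := by rw [hseq, hS0]; simp [b, hS0]
  have hwirt (x : Plane) : wirt (fun x => L x + series g x) x = 1 + series s x := by
    have h1 : series s x = (series (dcoef 0 g) x - Complex.I * series (dcoef 1 g) x) / 2 := by
      rw [series, series, series, ← tsum_mul_left,
        ← ((hg.dcoef 0).summable x).tsum_sub (((hg.dcoef 1).summable x).mul_left _),
        ← tsum_div_const]
      refine tsum_congr fun n => ?_
      have h2 : s n = τ n * g n := by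
        rw [hseq, hba]
        simp only [S, g, w, Pi.add_apply]
        ring
      rw [h2]
      simp only [dcoef, τ]
      ring
    rw [wirt, hd0, hd1, h1]
    linear_combination ((-1 + w 0) / 2) * Complex.I_sq
  have hwirtBar (x : Plane) : wirtBar (fun x => L x + series g x) x = series w x := by
    have h1 : series w x = w 0 + (series (dcoef 0 g) x + Complex.I * series (dcoef 1 g) x) / 2 := by
      have h0 : w = Pi.single 0 (w 0) + fun n => σ n * g n := by
        ext n
        rcases eq_or_ne n 0 with rfl | hn
        · simp [hσ0]
        · simp [g, hn, mul_div_cancel₀ _ (hσn n hn)]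
      have hr : RapidDecay fun n => σ n * g n := hw.of_norm_le fun n => by
        rcases eq_or_ne n 0 with rfl | hn
        · simp [hσ0]
        · simp [g, mul_div_cancel₀ _ (hσn n hn)]
      conv_lhs => rw [h0, (rapidDecay_single 0 (w 0)).series_add hr, series_single_zero]
      congr 1
      rw [series, series, series, ← tsum_mul_left,
        ← ((hg.dcoef 0).summable x).tsum_add (((hg.dcoef 1).summable x).mul_left _),
        ← tsum_div_const]
      refine tsum_congr fun n => ?_
      simp only [dcoef, σ]
      ring
    rw [wirtBar, hd0, hd1, h1]
    linear_combination ((1 - w 0) / 2) * Complex.I_sq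
  refine ⟨fun x => L x + series g x, L.contDiff.add hg.contDiff_series, fun x h0 => ?_, fun x => ?_⟩
  · rw [hwirt] at h0
    have h1 : ‖series s x‖ = 1 := by
      rw [eq_neg_of_add_eq_zero_right h0, norm_neg, norm_one]
    linarith [hs.norm_series_le x]
  · rw [hwirt, hwirtBar, ha.series_add (ha.conv hs), ← ha.series_mul hs,
      (rapidDecay_single 0 μ₀).series_add hc, series_single_zero]
    ring

end Wirtinger

end RiemSurf

end

/-! ### Fourier coefficients of functions supported in a period cell. -/

noncomputable section

namespace RiemSurf

open Set Filter Topology MeasureTheory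

section FourierSeries

open scoped FourierTransform

/-- The frequencies as points of the plane. -/
def freqVec (n : Freq) : Plane := WithLp.toLp 2 fun i => (n i : ℝ)

/-- The Fourier coefficients of a function supported in the unit square. -/
def fcoef (f : Plane → ℂ) (n : Freq) : ℂ := 𝓕 f (freqVec n)

lemma norm_le_norm_freqVec (n : Freq) : ‖n‖ ≤ ‖freqVec n‖ := by
  refine (pi_norm_le_iff_of_nonneg (norm_nonneg _)).2 fun i => ?_
  have := PiLp.norm_apply_le (freqVec n) i
  simpa [freqVec, Int.norm_eq_abs] using this

/-- The lift of a function on the plane, supported in the unit square, to the torus. -/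
def torusLift (f : Plane → ℂ) (t : UnitAddTorus (Fin 2)) : ℂ :=
  f (WithLp.toLp 2 fun i => (AddCircle.equivIoc (1 : ℝ) (-(1 / 2)) (t i) : ℝ))

lemma norm_eq_abs_equivIoc (s : AddCircle (1 : ℝ)) :
    ‖s‖ = |(AddCircle.equivIoc (1 : ℝ) (-(1 / 2)) s : ℝ)| := by
  set x := AddCircle.equivIoc (1 : ℝ) (-(1 / 2)) s with hx
  have h1 : ((x : ℝ) : AddCircle (1 : ℝ)) = s := AddCircle.coe_equivIoc (p := (1 : ℝ))
  have h2 := x.2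
  rw [← h1, AddCircle.norm_coe_eq_abs_iff _ one_ne_zero, abs_one, abs_le]
  constructor <;> linarith [h2.1, h2.2]

/-- The coordinates on the torus jump only where some coordinate is `-1/2`; near such a point the
lift vanishes, since the support lies in the ball of radius `1/4`. -/
lemma continuous_torusLift {f : Plane → ℂ} (hf : Continuous f)
    (hsupp : ∀ x, 1 / 4 < ‖x‖ → f x = 0) : Continuous (torusLift f) := by
  refine continuous_iff_continuousAt.2 fun t => ?_
  by_cases ht : ∀ i, t i ≠ ((-(1 / 2) : ℝ) : AddCircle (1 : ℝ))
  · refine hf.continuousAt.comp ((PiLp.continuous_toLp 2 _).continuousAt.comp ?_)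
    refine continuousAt_pi.2 fun i => ?_
    exact continuous_subtype_val.continuousAt.comp
      (ContinuousAt.comp (f := fun t : UnitAddTorus (Fin 2) => t i)
        (AddCircle.continuousAt_equivIoc (1 : ℝ) (-(1 / 2)) (ht i))
        (continuous_apply i).continuousAt)
  · push Not at ht
    obtain ⟨i, hi⟩ := ht
    have h1 : ∀ᶠ t' : UnitAddTorus (Fin 2) in 𝓝 t, 1 / 4 < ‖t' i‖ := by
      refine (continuous_norm.comp (continuous_apply i)).continuousAt.eventually_const_lt ?_
      have : ‖((-(1 / 2) : ℝ) : AddCircle (1 : ℝ))‖ = |-(1 / 2)| := by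
        rw [AddCircle.norm_coe_eq_abs_iff _ one_ne_zero, abs_one, abs_neg, abs_of_pos]
        all_goals norm_num
      rw [Function.comp_apply, hi, this]
      norm_num
    have h2 : torusLift f =ᶠ[𝓝 t] fun _ => 0 := by
      filter_upwards [h1] with t' ht'
      refine hsupp _ (ht'.trans_le ?_)
      rw [norm_eq_abs_equivIoc]
      exact PiLp.norm_apply_le (WithLp.toLp 2 fun i =>
        (AddCircle.equivIoc (1 : ℝ) (-(1 / 2)) (t' i) : ℝ)) i
    exact continuousAt_const.congr h2.symm

lemma torusLift_coe {f : Plane → ℂ} {x : Fin 2 → ℝ} (hx : ∀ i, x i ∈ Ioc (-(1 / 2) : ℝ) (1 / 2)) :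
    torusLift f (fun i => (x i : AddCircle (1 : ℝ))) = f (WithLp.toLp 2 x) := by
  rw [torusLift]
  congr 2
  ext i
  exact AddCircle.equivIoc_coe_of_mem (p := (1 : ℝ)) (a := -(1 / 2))
    ⟨(hx i).1, (hx i).2.trans_eq (by norm_num)⟩

lemma mFourier_coe (n : Freq) (x : Fin 2 → ℝ) :
    UnitAddTorus.mFourier n (fun i => (x i : AddCircle (1 : ℝ))) = char n (WithLp.toLp 2 x) := by
  simp only [UnitAddTorus.mFourier, ContinuousMap.coe_mk, Fin.prod_univ_two, fourier_coe_apply,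
    ← Complex.exp_add, char, phase_apply]
  congr 1
  push_cast
  ring

/-- The integral over one period cell is an integral over the plane because of the support
condition, and `char (-n)` is the Fourier kernel at the frequency `n`. -/
lemma mFourierCoeff_torusLift {f : Plane → ℂ} (hsupp : ∀ x, 1 / 4 < ‖x‖ → f x = 0) (n : Freq) :
    UnitAddTorus.mFourierCoeff (torusLift f) n = fcoef f n := by
  rw [UnitAddTorus.mFourierCoeff_eq_integral _ _ fun _ => -(1 / 2)]
  have h1 (x : Fin 2 → ℝ) (hx : x ∈ {x : Fin 2 → ℝ | ∀ i, x i ∈ Ioc (-(1 / 2)) (-(1 / 2) + 1)}) :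
      UnitAddTorus.mFourier (-n) (fun i => (x i : AddCircle (1 : ℝ))) •
        torusLift f (fun i => (x i : AddCircle (1 : ℝ))) =
      char (-n) (WithLp.toLp 2 x) * f (WithLp.toLp 2 x) := by
    rw [mFourier_coe, torusLift_coe fun i => ⟨(hx i).1, (hx i).2.trans_eq (by norm_num)⟩,
      smul_eq_mul]
  have hmeas : MeasurableSet {x : Fin 2 → ℝ | ∀ i, x i ∈ Ioc (-(1 / 2) : ℝ) (-(1 / 2) + 1)} :=
    MeasurableSet.univ_pi' fun i => measurableSet_Ioc
  rw [setIntegral_congr_fun hmeas h1, setIntegral_eq_integral_of_forall_compl_eq_zero fun x hx => ?_]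
  · rw [fcoef, Real.fourier_eq',
      ← (PiLp.volume_preserving_toLp (Fin 2)).integral_comp
        (MeasurableEquiv.toLp 2 (Fin 2 → ℝ)).measurableEmbedding]
    refine integral_congr_ae (Eventually.of_forall fun x => ?_)
    simp only [smul_eq_mul, char, phase_apply, freqVec, PiLp.inner_apply, Fin.sum_univ_two]
    congr 2
    simp
    ring
  · rw [hsupp, mul_zero]
    simp only [Set.mem_ofPred_eq, not_forall] at hx
    obtain ⟨i, hi⟩ := hx
    have h2 := PiLp.norm_apply_le (WithLp.toLp 2 x : Plane) i
    refine lt_of_lt_of_le ?_ h2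
    rw [Real.norm_eq_abs, lt_abs]
    by_contra! h3
    exact hi ⟨by linarith [h3.2], by linarith [h3.1]⟩

lemma series_fcoef {f : Plane → ℂ} (hf : Continuous f) (hsupp : ∀ x, 1 / 4 < ‖x‖ → f x = 0)
    (hc : RapidDecay (fcoef f)) {x : Plane} (hx : ‖x‖ < 1 / 2) : series (fcoef f) x = f x := by
  let F : C(UnitAddTorus (Fin 2), ℂ) := ⟨torusLift f, continuous_torusLift hf hsupp⟩
  have h1 : UnitAddTorus.mFourierCoeff F = fcoef f := funext (mFourierCoeff_torusLift hsupp)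
  have h2 := UnitAddTorus.hasSum_mFourier_series_apply_of_summable (f := F)
    (by rw [h1]; exact hc.summable_norm.of_norm) (fun i => (x i : AddCircle (1 : ℝ)))
  have h3 (i : Fin 2) : x i ∈ Ioc (-(1 / 2) : ℝ) (1 / 2) := by
    have := (PiLp.norm_apply_le x i).trans_lt hx
    rw [Real.norm_eq_abs, abs_lt] at this
    exact ⟨this.1, this.2.le⟩
  rw [h1] at h2
  have h4 : F (fun i => (x i : AddCircle (1 : ℝ))) = f x := torusLift_coe (x := x.ofLp) h3
  rw [← h4, ← h2.tsum_eq]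
  refine tsum_congr fun n => ?_
  rw [smul_eq_mul, mFourier_coe n x.ofLp]

end FourierSeries

section Localization

open scoped FourierTransform

lemma iteratedFDeriv_eq_zero_of_support {f : Plane → ℂ} (hsupp : ∀ x, 1 / 4 < ‖x‖ → f x = 0)
    (q : ℕ) {x : Plane} (hx : x ∉ Metric.closedBall (0 : Plane) (1 / 4)) :
    iteratedFDeriv ℝ q f x = 0 := by
  have h1 : tsupport f ⊆ Metric.closedBall 0 (1 / 4) := by
    refine closure_minimal (fun y hy => ?_) Metric.isClosed_closedBall
    by_contra h
    exact hy (hsupp y (by simpa using h))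
  by_contra h
  exact hx (h1 (support_iteratedFDeriv_subset q h))

/-- The Fourier coefficients of a family of smooth functions of bounded support decay rapidly,
uniformly for parameters in `[0, 1]`. -/
lemma exists_fcoef_bound {g : ℝ × Plane → ℂ} (hg : ContDiff ℝ ∞ g)
    (hsupp : ∀ r x, 1 / 4 < ‖x‖ → g (r, x) = 0) (k : ℕ) :
    ∃ B : ℝ, ∀ r ∈ Icc (0 : ℝ) 1, ∀ n, ‖freqVec n‖ ^ k * ‖fcoef (fun x => g (r, x)) n‖ ≤ B := by
  have hslice (r : ℝ) : ContDiff ℝ ∞ fun x => g (r, x) := hg.comp (contDiff_const.prodMk contDiff_id)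
  have hbound (q : ℕ) : ∃ B : ℝ, 0 ≤ B ∧ ∀ r ∈ Icc (0 : ℝ) 1, ∀ x,
      ‖iteratedFDeriv ℝ q (fun x => g (r, x)) x‖ ≤
        (Metric.closedBall (0 : Plane) (1 / 4)).indicator (fun _ => B) x := by
    obtain ⟨B, hB⟩ := (isCompact_Icc (a := (0 : ℝ)) (b := 1)).prod
      (isCompact_closedBall (0 : Plane) (1 / 4)) |>.exists_bound_of_continuousOn
      (hg.continuous_iteratedFDeriv (m := q) (by exact_mod_cast le_top)).continuousOn
    refine ⟨max B 0 * ∏ _i : Fin q, ‖ContinuousLinearMap.inr ℝ ℝ Plane‖, by positivity,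
      fun r hr x => ?_⟩
    by_cases hx : x ∈ Metric.closedBall (0 : Plane) (1 / 4)
    · rw [indicator_of_mem hx]
      -- The derivatives of a slice are restrictions of those of `g`, which are bounded on the
      -- compact set `[0, 1] × closedBall 0 (1/4)`. This makes the bound uniform in `r`.
      have h1 : (fun x => g (r, x)) =
          (fun z => g ((r, 0) + z)) ∘ ContinuousLinearMap.inr ℝ ℝ Plane := by
        ext x; simp
      have h2 : ContDiff ℝ ∞ fun z => g ((r, 0) + z) := hg.comp (contDiff_const.add contDiff_id)
      rw [h1, ContinuousLinearMap.iteratedFDeriv_comp_right _ h2 x (by exact_mod_cast le_top),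
        iteratedFDeriv_comp_add_left]
      refine (ContinuousMultilinearMap.norm_compContinuousLinearMap_le _ _).trans ?_
      gcongr
      refine le_trans ?_ (le_max_left _ _)
      have h3 := hB (r, x) ⟨hr, hx⟩
      simpa using h3
    · rw [indicator_of_notMem hx, iteratedFDeriv_eq_zero_of_support (hsupp r) q hx, norm_zero]
  choose B hB0 hB using hbound
  have hind (q : ℕ) : Integrable
      ((Metric.closedBall (0 : Plane) (1 / 4)).indicator fun _ => B q) :=
    (integrable_indicator_iff Metric.isClosed_closedBall.measurableSet).2
      (integrableOn_const (isCompact_closedBall _ _).measure_lt_top.ne)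
  -- The constant is that of the estimate for the Fourier transform applied below, without
  -- derivatives of the transform and with `k` powers of the frequency.
  refine ⟨2 ^ k * ∑ q ∈ Finset.range (k + 1), ∫ x,
    (Metric.closedBall (0 : Plane) (1 / 4)).indicator (fun _ => B q) x, fun r hr n => ?_⟩
  have hint (q : ℕ) : Integrable fun v => ‖iteratedFDeriv ℝ q (fun x => g (r, x)) v‖ := by
    refine (hind q).mono' ?_ (Eventually.of_forall fun x => by simpa using hB q r hr x)
    exact ((hslice r).continuous_iteratedFDeriv (m := q)
      (by exact_mod_cast le_top)).norm.aestronglyMeasurable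
  have h := Real.pow_mul_norm_iteratedFDeriv_fourier_le (K := 0) (N := ⊤) (hslice r)
    (fun k n hk _ => by
      have : k = 0 := by simpa using hk
      subst this
      simpa using hint n) (k := 0) (n := k) le_rfl le_top (freqVec n)
  rw [norm_iteratedFDeriv_zero] at h
  refine h.trans ?_
  simp only [pow_zero, one_mul, Nat.cast_zero, mul_zero, zero_add, Finset.range_one,
    Finset.singleton_product, Finset.sum_map, Function.Embedding.coeFn_mk]
  gcongr with q hq
  · exact hint q
  · exact hind q
  · exact fun x => hB q r hr x

end Localization

end RiemSurf

end

/-! ### Local solution of the Beltrami equation by zooming in. -/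

noncomputable section

namespace RiemSurf

open Set Filter Topology MeasureTheory

section SmallOscillation

open scoped FourierTransform

lemma exists_summable_fcoef_bound {g : ℝ × Plane → ℂ} (hg : ContDiff ℝ ∞ g)
    (hsupp : ∀ r x, 1 / 4 < ‖x‖ → g (r, x) = 0) (k : ℕ) :
    ∃ u : Freq → ℝ, Summable u ∧ ∀ r ∈ Icc (0 : ℝ) 1, ∀ n,
      (1 + ‖n‖) ^ k * ‖fcoef (fun x => g (r, x)) n‖ ≤ u n := by
  obtain ⟨B₀, hB₀⟩ := exists_fcoef_bound hg hsupp 0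
  obtain ⟨B, hB⟩ := exists_fcoef_bound hg hsupp (k + 3)
  -- Three extra powers of decay suffice, as `‖n‖ ^ (-3)` is summable over the rank two lattice. The
  -- zero frequency needs its own bound `B₀`.
  refine ⟨fun n => 2 ^ k * B * ‖n‖ ^ (-3 : ℝ) + if n = 0 then B₀ else 0,
    ((EisensteinSeries.summable_one_div_norm_rpow (by norm_num)).mul_left _).add
      (hasSum_ite_eq 0 B₀).summable, fun r hr n => ?_⟩
  rcases eq_or_ne n 0 with rfl | hn
  · simpa using hB₀ r hr 0
  · have h1 : 1 ≤ ‖n‖ := by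
      obtain ⟨i, hi⟩ := Function.ne_iff.1 hn
      refine le_trans ?_ (norm_le_pi_norm n i)
      rw [Int.norm_eq_abs]
      exact_mod_cast Int.one_le_abs hi
    have h0 : 0 < ‖n‖ := one_pos.trans_le h1
    simp only [hn, if_false, add_zero]
    rw [Real.rpow_neg h0.le, ← div_eq_mul_inv, le_div_iff₀ (by positivity)]
    have h2 : ‖n‖ ^ (3 : ℝ) = ‖n‖ ^ 3 := by exact_mod_cast Real.rpow_natCast ‖n‖ 3
    rw [h2]
    calc (1 + ‖n‖) ^ k * ‖fcoef (fun x => g (r, x)) n‖ * ‖n‖ ^ 3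
        ≤ (2 * ‖n‖) ^ k * ‖fcoef (fun x => g (r, x)) n‖ * ‖n‖ ^ 3 := by
          gcongr
          linarith
      _ = 2 ^ k * (‖n‖ ^ (k + 3) * ‖fcoef (fun x => g (r, x)) n‖) := by ring
      _ ≤ 2 ^ k * (‖freqVec n‖ ^ (k + 3) * ‖fcoef (fun x => g (r, x)) n‖) := by
          gcongr
          exact norm_le_norm_freqVec n
      _ ≤ 2 ^ k * B := by
          gcongr
          exact hB r hr n

lemma rapidDecay_fcoef {g : ℝ × Plane → ℂ} (hg : ContDiff ℝ ∞ g)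
    (hsupp : ∀ r x, 1 / 4 < ‖x‖ → g (r, x) = 0) {r : ℝ} (hr : r ∈ Icc (0 : ℝ) 1) :
    RapidDecay (fcoef fun x => g (r, x)) := fun k => by
  obtain ⟨u, hu, h⟩ := exists_summable_fcoef_bound hg hsupp k
  exact hu.of_nonneg_of_le (fun n => by positivity) (h r hr)

/-- Each coefficient is continuous in `r` and vanishes at `r = 0`; the uniform summable bound allows
the limit to be taken inside the sum. -/
lemma tendsto_tsum_fcoef {g : ℝ × Plane → ℂ} (hg : ContDiff ℝ ∞ g)
    (hsupp : ∀ r x, 1 / 4 < ‖x‖ → g (r, x) = 0) (h0 : ∀ x, g (0, x) = 0) :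
    Tendsto (fun r => ∑' n, ‖fcoef (fun x => g (r, x)) n‖) (𝓝[Icc (0 : ℝ) 1] 0) (𝓝 0) := by
  obtain ⟨u, hu, h⟩ := exists_summable_fcoef_bound hg hsupp 0
  have hlim (n : Freq) : Tendsto (fun r => ‖fcoef (fun x => g (r, x)) n‖)
      (𝓝[Icc (0 : ℝ) 1] 0) (𝓝 ‖(0 : ℂ)‖) := by
    have h1 : ContinuousOn (fun r : ℝ => fcoef (fun x => g (r, x)) n) univ := by
      simp only [fcoef, Real.fourier_eq']
      refine continuousOn_integral_of_compact_support
        (isCompact_closedBall (0 : Plane) (1 / 4)) ?_ fun r x _ hx => ?_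
      · refine Continuous.continuousOn ?_
        have := hg.continuous
        simp only [Function.uncurry_def]
        fun_prop
      · rw [hsupp r x (by simpa using hx), smul_zero]
    have h2 : fcoef (fun x => g (0, x)) n = 0 := by
      simp [fcoef, Real.fourier_eq', h0]
    rw [← h2]
    exact ((continuousOn_univ.1 h1).continuousAt.norm).mono_left nhdsWithin_le_nhds
  have := tendsto_tsum_of_dominated_convergence (bound := u) hu hlim (by
    filter_upwards [self_mem_nhdsWithin] with r hr n
    simpa using h r hr n)
  simpa using this

/-- The oscillation `μ (r x) - μ 0`, cut off to a period cell, has small Fourier coefficients when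
`r` is small. Solving the periodic equation and rescaling by `r⁻¹` gives a solution where the cutoff
equals one. -/
lemma exists_beltrami_of_contDiff {μ : Plane → ℂ} (hμ : ContDiff ℝ ∞ μ) (h : ‖μ 0‖ < 1) :
    ∃ f : Plane → ℂ, ContDiff ℝ ∞ f ∧ (∀ x, wirt f x ≠ 0) ∧
      ∀ᶠ x in 𝓝 0, wirtBar f x = μ x * wirt f x := by
  let χ : ContDiffBump (0 : Plane) := ⟨1 / 8, 1 / 4, by norm_num, by norm_num⟩
  let g (z : ℝ × Plane) : ℂ := χ z.2 * (μ (z.1 • z.2) - μ 0)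
  have hg : ContDiff ℝ ∞ g :=
    (Complex.ofRealCLM.contDiff.comp (χ.contDiff.comp contDiff_snd)).mul
      ((hμ.comp (contDiff_fst.smul contDiff_snd)).sub contDiff_const)
  have hsupp (r : ℝ) (x : Plane) (hx : 1 / 4 < ‖x‖) : g (r, x) = 0 := by
    have h1 : χ x = 0 := χ.zero_of_le_dist (by rw [dist_zero_right]; exact hx.le)
    simp only [g, h1, Complex.ofReal_zero, zero_mul]
  obtain ⟨r, ⟨hr, hr0⟩, hr1⟩ : ∃ r : ℝ, (‖μ 0‖ + 2 * ∑' n, ‖fcoef (fun x => g (r, x)) n‖ < 1 ∧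
      0 < r) ∧ r ≤ 1 := by
    have h1 := (((tendsto_tsum_fcoef hg hsupp fun x => by simp [g]).const_mul 2).const_add ‖μ 0‖)
    rw [mul_zero, add_zero] at h1
    have h2 : 𝓝[Ioc (0 : ℝ) 1] 0 ≤ 𝓝[Icc (0 : ℝ) 1] 0 := nhdsWithin_mono _ Ioc_subset_Icc_self
    have : (𝓝[Ioc (0 : ℝ) 1] 0).NeBot := by
      rw [nhdsWithin_Ioc_eq_nhdsGT one_pos]
      infer_instance
    obtain ⟨r, hr, hr'⟩ := ((h1.mono_left h2).eventually_lt_const h |>.and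
      self_mem_nhdsWithin).exists
    exact ⟨r, ⟨hr, hr'.1⟩, hr'.2⟩
  have hc := rapidDecay_fcoef hg hsupp ⟨hr0.le, hr1⟩
  obtain ⟨f, hf, hf1, hf2⟩ := exists_beltrami_periodic hc hr
  have hw (x : Plane) : wirt (fun x => f (r⁻¹ • x)) x = r⁻¹ * wirt f (r⁻¹ • x) := by
    simp only [wirt, fderiv_comp_smul, smul_apply, Complex.real_smul]
    ring
  have hw' (x : Plane) : wirtBar (fun x => f (r⁻¹ • x)) x = r⁻¹ * wirtBar f (r⁻¹ • x) := by
    simp only [wirtBar, fderiv_comp_smul, smul_apply, Complex.real_smul]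
    ring
  refine ⟨fun x => f (r⁻¹ • x), hf.comp (contDiff_const_smul _), fun x => ?_, ?_⟩
  · rw [hw]
    exact mul_ne_zero (by exact_mod_cast (inv_pos.2 hr0).ne') (hf1 _)
  · have h3 : ∀ᶠ x : Plane in 𝓝 0, ‖r⁻¹ • x‖ < 1 / 8 := by
      have : Continuous fun x : Plane => ‖r⁻¹ • x‖ := by fun_prop
      refine this.continuousAt.eventually_lt_const ?_
      simp
    filter_upwards [h3] with x hx
    have hgr : Continuous fun x => g (r, x) := hg.continuous.comp (by fun_prop)
    rw [hw, hw', hf2, series_fcoef hgr (hsupp r) hc (hx.trans (by norm_num))]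
    have h4 : χ (r⁻¹ • x) = 1 := χ.one_of_mem_closedBall (by rw [mem_closedBall_zero_iff]; exact hx.le)
    simp only [g, h4, smul_inv_smul₀ hr0.ne', Complex.ofReal_one]
    ring

/-- Local solvability of the Beltrami equation with a smooth coefficient. -/
theorem exists_beltrami {μ : Plane → ℂ} {U : Set Plane} (hU : IsOpen U)
    (hμ : ContDiffOn ℝ ∞ μ U) {x₀ : Plane} (hx₀ : x₀ ∈ U) (h : ‖μ x₀‖ < 1) :
    ∃ f : Plane → ℂ, ContDiff ℝ ∞ f ∧ (∀ x, wirt f x ≠ 0) ∧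
      ∀ᶠ x in 𝓝 x₀, wirtBar f x = μ x * wirt f x := by
  obtain ⟨ε, hε, hεU⟩ := Metric.isOpen_iff.1 hU x₀ hx₀
  -- Multiplying by the cutoff extends `μ` smoothly from a neighbourhood of `x₀` to the whole plane;
  -- the closed ball of radius `ε / 2` stays inside `U`.
  let χ : ContDiffBump x₀ := ⟨ε / 3, ε / 2, by positivity, by linarith⟩
  have h1 : ContDiff ℝ ∞ fun x => (χ x : ℂ) * μ x := by
    refine contDiff_iff_contDiffAt.2 fun x => ?_
    by_cases hx : x ∈ U
    · exact (Complex.ofRealCLM.contDiff.comp χ.contDiff).contDiffAt.mul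
        (hμ.contDiffAt (hU.mem_nhds hx))
    · have h2 : x ∈ (Metric.closedBall x₀ (ε / 2))ᶜ := fun h' =>
        hx (hεU (Metric.closedBall_subset_ball (by linarith) h'))
      refine (contDiffAt_const (c := (0 : ℂ))).congr_of_eventuallyEq ?_
      filter_upwards [Metric.isClosed_closedBall.isOpen_compl.mem_nhds h2] with y hy
      have hy' : χ.rOut < dist y x₀ := by simpa [Metric.mem_closedBall] using hy
      rw [χ.zero_of_le_dist hy'.le, Complex.ofReal_zero, zero_mul]
  have h3 : ContDiff ℝ ∞ fun x => (χ (x₀ + x) : ℂ) * μ (x₀ + x) :=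
    h1.comp (contDiff_const.add contDiff_id)
  obtain ⟨f, hf, hf1, hf2⟩ := exists_beltrami_of_contDiff h3 (by simpa [χ.one_of_mem_closedBall (Metric.mem_closedBall_self χ.rIn_pos.le)] using h)
  have hw (x : Plane) : wirt (fun x => f (x - x₀)) x = wirt f (x - x₀) := by
    simp only [wirt, fderiv_comp_sub]
  have hw' (x : Plane) : wirtBar (fun x => f (x - x₀)) x = wirtBar f (x - x₀) := by
    simp only [wirtBar, fderiv_comp_sub]
  refine ⟨fun x => f (x - x₀), hf.comp (contDiff_id.sub contDiff_const), fun x => ?_, ?_⟩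
  · rw [hw]
    exact hf1 _
  · have h4 : Tendsto (fun x => x - x₀) (𝓝 x₀) (𝓝 0) := by
      have : Continuous fun x => x - x₀ := by fun_prop
      simpa using this.tendsto x₀
    filter_upwards [h4.eventually hf2, χ.eventuallyEq_one] with x hx hx'
    rw [hw, hw', hx]
    simp only [add_sub_cancel, hx', Pi.one_apply, Complex.ofReal_one, one_mul]

end SmallOscillation

end RiemSurf

end

/-! ### Conformal flatness from the Beltrami equation. -/

noncomputable section

namespace RiemSurf

open Set Filter Topology

section Flat

/-- The area density of the metric `E dx² + 2F dx dy + G dy²`. -/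
def areaDensity (E F G : ℝ) : ℝ := √(E * G - F ^ 2)

/-- The Beltrami coefficient of the metric `E dx² + 2F dx dy + G dy²`. -/
def beltramiCoef (E F G : ℝ) : ℂ :=
  ((E - G : ℝ) + (2 * F : ℝ) * Complex.I) / (E + G + 2 * areaDensity E F G : ℝ)

section

variable {E F G : ℝ}

lemma beltramiCoef_re : (beltramiCoef E F G).re = (E - G) / (E + G + 2 * areaDensity E F G) := by
  rw [beltramiCoef, Complex.div_ofReal_re]
  simp

lemma beltramiCoef_im : (beltramiCoef E F G).im = 2 * F / (E + G + 2 * areaDensity E F G) := by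
  rw [beltramiCoef, Complex.div_ofReal_im]
  simp

lemma areaDensity_pos (h : 0 < E * G - F ^ 2) : 0 < areaDensity E F G := Real.sqrt_pos.2 h

lemma sq_areaDensity (h : 0 < E * G - F ^ 2) : areaDensity E F G ^ 2 = E * G - F ^ 2 :=
  Real.sq_sqrt h.le

lemma add_areaDensity_pos (hE : 0 < E) (h : 0 < E * G - F ^ 2) :
    0 < E + G + 2 * areaDensity E F G := by
  have hG : 0 < G := by
    by_contra! hG
    nlinarith [mul_nonneg hE.le (neg_nonneg.2 hG), sq_nonneg F]
  have := areaDensity_pos h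
  positivity

/-- With `N = E + G + 2 √(EG - F²)`, the form `|dz + μ dz̄|²` has coefficients `|1 + μ|² = 4E/N`, `2
Im μ = 4F/N` and `|1 - μ|² = 4G/N`. It is therefore `4/N` times the given metric. -/
lemma normSq_one_add_beltramiCoef (hE : 0 < E) (h : 0 < E * G - F ^ 2) :
    Complex.normSq (1 + beltramiCoef E F G) = 4 * E / (E + G + 2 * areaDensity E F G) := by
  have h1 := (add_areaDensity_pos hE h).ne'
  have h2 := sq_areaDensity h
  simp only [Complex.normSq_apply, Complex.add_re, Complex.add_im, Complex.one_re, Complex.one_im,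
    beltramiCoef_re, beltramiCoef_im]
  field_simp
  linear_combination 4 * h2

lemma normSq_one_sub_beltramiCoef (hE : 0 < E) (h : 0 < E * G - F ^ 2) :
    Complex.normSq (1 - beltramiCoef E F G) = 4 * G / (E + G + 2 * areaDensity E F G) := by
  have h1 := (add_areaDensity_pos hE h).ne'
  have h2 := sq_areaDensity h
  simp only [Complex.normSq_apply, Complex.sub_re, Complex.sub_im, Complex.one_re, Complex.one_im,
    beltramiCoef_re, beltramiCoef_im]
  field_simp
  linear_combination 4 * h2

lemma one_sub_normSq_beltramiCoef (hE : 0 < E) (h : 0 < E * G - F ^ 2) :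
    1 - Complex.normSq (beltramiCoef E F G) =
      4 * areaDensity E F G / (E + G + 2 * areaDensity E F G) := by
  have h1 := (add_areaDensity_pos hE h).ne'
  have h2 := sq_areaDensity h
  simp only [Complex.normSq_apply, beltramiCoef_re, beltramiCoef_im]
  field_simp
  linear_combination -4 * h2

lemma norm_beltramiCoef_lt_one (hE : 0 < E) (h : 0 < E * G - F ^ 2) :
    ‖beltramiCoef E F G‖ < 1 := by
  have h1 := one_sub_normSq_beltramiCoef hE h
  have h2 : 0 < 4 * areaDensity E F G / (E + G + 2 * areaDensity E F G) :=
    div_pos (mul_pos (by norm_num) (areaDensity_pos h)) (add_areaDensity_pos hE h)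
  rw [Complex.normSq_eq_norm_sq] at h1
  nlinarith [norm_nonneg (beltramiCoef E F G)]

end

lemma det_plane (A : Plane →L[ℝ] Plane) :
    A.det = A (unitVec 0) 0 * A (unitVec 1) 1 - A (unitVec 1) 0 * A (unitVec 0) 1 := by
  rw [ContinuousLinearMap.det, ← LinearMap.det_toMatrix (EuclideanSpace.basisFun (Fin 2) ℝ).toBasis,
    Matrix.det_fin_two]
  simp [LinearMap.toMatrix_apply]

variable {f : Plane → ℂ} {x : Plane}

lemma hasFDerivAt_toPlane_comp (hf : DifferentiableAt ℝ f x) :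
    HasFDerivAt (fun x => toPlane (f x))
      (Complex.orthonormalBasisOneI.repr.toContinuousLinearEquiv.toContinuousLinearMap ∘L
        fderiv ℝ f x) x := by
  simp only [toPlane_eq_repr]
  exact Complex.orthonormalBasisOneI.repr.toContinuousLinearEquiv.toContinuousLinearMap.hasFDerivAt
    |>.comp x hf.hasFDerivAt

lemma fderiv_toPlane_comp (hf : DifferentiableAt ℝ f x) (v : Plane) :
    fderiv ℝ (fun x => toPlane (f x)) x v = toPlane (fderiv ℝ f x v) := by
  rw [(hasFDerivAt_toPlane_comp hf).fderiv, toPlane_eq_repr]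
  rfl

lemma contDiff_toPlane_comp (hf : ContDiff ℝ ∞ f) : ContDiff ℝ ∞ fun x => toPlane (f x) := by
  simp only [toPlane_eq_repr]
  exact Complex.orthonormalBasisOneI.repr.toContinuousLinearEquiv.toContinuousLinearMap.contDiff.comp
    hf

lemma fderiv_unitVec_zero {μ : ℂ} (h : wirtBar f x = μ * wirt f x) :
    fderiv ℝ f x (unitVec 0) = wirt f x * (1 + μ) := by
  have : fderiv ℝ f x (unitVec 0) = wirt f x + wirtBar f x := by
    rw [wirt, wirtBar]
    ring
  rw [this, h]
  ring

lemma fderiv_unitVec_one {μ : ℂ} (h : wirtBar f x = μ * wirt f x) :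
    fderiv ℝ f x (unitVec 1) = Complex.I * wirt f x * (1 - μ) := by
  have : fderiv ℝ f x (unitVec 1) = Complex.I * (wirt f x - wirtBar f x) := by
    rw [wirt, wirtBar]
    linear_combination fderiv ℝ f x (unitVec 1) * Complex.I_sq
  rw [this, h]
  ring

section

variable {E F G : ℝ}

/-- The Jacobian is `|f_z|² - |f_z̄|²`, so `|μ| < 1` and `f_z ≠ 0` make the solution an
orientation-preserving local diffeomorphism. -/
lemma det_fderiv_of_beltrami (hf : DifferentiableAt ℝ f x) {μ : ℂ}
    (h : wirtBar f x = μ * wirt f x) :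
    (fderiv ℝ (fun x => toPlane (f x)) x).det =
      Complex.normSq (wirt f x) * (1 - Complex.normSq μ) := by
  rw [det_plane, fderiv_toPlane_comp hf, fderiv_toPlane_comp hf, fderiv_unitVec_zero h,
    fderiv_unitVec_one h]
  simp [toPlane, Complex.normSq_apply]
  ring

/-- The metric `g = (g i j)` is conformal to the pullback of the flat metric by a solution of the
Beltrami equation. -/
lemma inner_fderiv_of_beltrami (hf : DifferentiableAt ℝ f x) {g : Fin 2 → Fin 2 → ℝ}
    (hs : g 1 0 = g 0 1) (hE : 0 < g 0 0) (hd : 0 < g 0 0 * g 1 1 - g 0 1 ^ 2)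
    (h : wirtBar f x = beltramiCoef (g 0 0) (g 0 1) (g 1 1) * wirt f x) (i j : Fin 2) :
    inner ℝ (fderiv ℝ (fun x => toPlane (f x)) x (unitVec i))
      (fderiv ℝ (fun x => toPlane (f x)) x (unitVec j)) =
    4 * Complex.normSq (wirt f x) / (g 0 0 + g 1 1 + 2 * areaDensity (g 0 0) (g 0 1) (g 1 1)) *
      g i j := by
  have hin (z w : ℂ) : inner ℝ (toPlane z) (toPlane w) = z.re * w.re + z.im * w.im := by
    simp [toPlane, PiLp.inner_apply, Fin.sum_univ_two]
    ring
  have hnorm (z : ℂ) : z.re * z.re + z.im * z.im = Complex.normSq z := rfl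
  have h00 := normSq_one_add_beltramiCoef hE hd
  have h11 := normSq_one_sub_beltramiCoef hE hd
  have h01 : inner ℝ (fderiv ℝ (fun x => toPlane (f x)) x (unitVec 0))
      (fderiv ℝ (fun x => toPlane (f x)) x (unitVec 1)) =
      4 * Complex.normSq (wirt f x) /
        (g 0 0 + g 1 1 + 2 * areaDensity (g 0 0) (g 0 1) (g 1 1)) * g 0 1 := by
    rw [fderiv_toPlane_comp hf, fderiv_toPlane_comp hf, fderiv_unitVec_zero h,
      fderiv_unitVec_one h, hin]
    have h2 := beltramiCoef_im (E := g 0 0) (F := g 0 1) (G := g 1 1)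
    generalize beltramiCoef (g 0 0) (g 0 1) (g 1 1) = μ at *
    generalize wirt f x = w at *
    trans Complex.normSq w * (2 * μ.im)
    · simp [Complex.normSq_apply]
      ring
    · rw [h2]
      ring
  fin_cases i <;> fin_cases j
  · simp only [Fin.zero_eta]
    rw [fderiv_toPlane_comp hf, fderiv_unitVec_zero h, hin, hnorm, map_mul, h00]
    ring
  · exact h01
  · refine (real_inner_comm _ _).trans (h01.trans ?_)
    simp [hs]
  · simp only [Fin.mk_one]
    rw [fderiv_toPlane_comp hf, fderiv_unitVec_one h, hin, hnorm, map_mul, map_mul, h11,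
      Complex.normSq_I]
    ring

end

/-- A smooth metric on an open subset of the plane is locally conformally flat. -/
theorem exists_conformal_diffeo {U : Set Plane} (hU : IsOpen U) {g : Fin 2 → Fin 2 → Plane → ℝ}
    (hg : ∀ i j, ContDiffOn ℝ ∞ (g i j) U) (hs : ∀ x ∈ U, g 1 0 x = g 0 1 x)
    (hE : ∀ x ∈ U, 0 < g 0 0 x) (hd : ∀ x ∈ U, 0 < g 0 0 x * g 1 1 x - g 0 1 x ^ 2) {x₀ : Plane}
    (hx₀ : x₀ ∈ U) :
    ∃ Φ : OpenPartialHomeomorph Plane Plane, x₀ ∈ Φ.source ∧ Φ.source ⊆ U ∧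
      ContDiffOn ℝ ∞ Φ Φ.source ∧ ContDiffOn ℝ ∞ Φ.symm Φ.target ∧
      (∀ x ∈ Φ.source, 0 < (fderiv ℝ Φ x).det) ∧
      ∃ l : Plane → ℝ, ContDiffOn ℝ ∞ l Φ.source ∧ ∀ x ∈ Φ.source, 0 < l x ∧ ∀ i j,
        inner ℝ (fderiv ℝ Φ x (unitVec i)) (fderiv ℝ Φ x (unitVec j)) = l x * g i j x := by
  let D (x : Plane) : ℝ := areaDensity (g 0 0 x) (g 0 1 x) (g 1 1 x)
  let N (x : Plane) : ℝ := g 0 0 x + g 1 1 x + 2 * D x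
  let μ (x : Plane) : ℂ := beltramiCoef (g 0 0 x) (g 0 1 x) (g 1 1 x)
  have hD : ContDiffOn ℝ ∞ D U :=
    (((hg 0 0).mul (hg 1 1)).sub ((hg 0 1).pow 2)).sqrt fun x hx => (hd x hx).ne'
  have hN : ContDiffOn ℝ ∞ N U := ((hg 0 0).add (hg 1 1)).add (contDiffOn_const.mul hD)
  have hN0 (x : Plane) (hx : x ∈ U) : 0 < N x := add_areaDensity_pos (hE x hx) (hd x hx)
  have hμ : ContDiffOn ℝ ∞ μ U := by
    have hr {u : Plane → ℝ} (hu : ContDiffOn ℝ ∞ u U) : ContDiffOn ℝ ∞ (fun x => (u x : ℂ)) U :=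
      Complex.ofRealCLM.contDiff.comp_contDiffOn hu
    simp only [μ, beltramiCoef, div_eq_mul_inv]
    exact ((hr ((hg 0 0).sub (hg 1 1))).add ((hr (contDiffOn_const.mul (hg 0 1))).mul
      contDiffOn_const)).mul ((hr hN).inv fun x hx => by exact_mod_cast (hN0 x hx).ne')
  obtain ⟨f, hf, hf0, hfμ⟩ := exists_beltrami hU hμ hx₀
    (norm_beltramiCoef_lt_one (hE x₀ hx₀) (hd x₀ hx₀))
  obtain ⟨V, hVμ, hV, hxV⟩ := mem_nhds_iff.1 hfμ
  have hfd (x : Plane) : DifferentiableAt ℝ f x := hf.differentiable (by simp) x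
  have hΨ := contDiff_toPlane_comp hf
  have hdet (x : Plane) (hx : x ∈ V ∩ U) : 0 < (fderiv ℝ (fun x => toPlane (f x)) x).det := by
    rw [det_fderiv_of_beltrami (hfd x) (hVμ hx.1),
      one_sub_normSq_beltramiCoef (hE x hx.2) (hd x hx.2)]
    exact mul_pos (Complex.normSq_pos.2 (hf0 x)) (div_pos (mul_pos (by norm_num)
      (areaDensity_pos (hd x hx.2))) (hN0 x hx.2))
  have hderiv (x : Plane) (hx : x ∈ V ∩ U) : HasFDerivAt (fun x => toPlane (f x))
      (((fderiv ℝ (fun x => toPlane (f x)) x).toContinuousLinearEquivOfDetNeZero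
        (hdet x hx).ne' : Plane ≃L[ℝ] Plane) : Plane →L[ℝ] Plane) x := by
    rw [ContinuousLinearMap.coe_toContinuousLinearEquivOfDetNeZero]
    exact (hΨ.differentiable (by simp) x).hasFDerivAt
  -- The inverse function theorem gives a local inverse, which is then restricted to the set where
  -- the Beltrami equation holds.
  let Φ₀ := hΨ.contDiffAt.toOpenPartialHomeomorph _ (hderiv x₀ ⟨hxV, hx₀⟩) (by simp)
  let Φ := Φ₀.restrOpen (V ∩ U) (hV.inter hU)
  have hsrc : Φ.source = Φ₀.source ∩ (V ∩ U) := Φ₀.restrOpen_source _ _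
  have hsub : Φ.source ⊆ V ∩ U := hsrc ▸ inter_subset_right
  have hcoe : ⇑Φ = fun x => toPlane (f x) := rfl
  refine ⟨Φ, ?_, fun x hx => (hsub hx).2, hcoe ▸ hΨ.contDiffOn, fun y hy => ?_,
    fun x hx => hcoe ▸ hdet x (hsub hx), fun x => 4 * Complex.normSq (wirt f x) / N x, ?_,
    fun x hx => ⟨?_, fun i j => ?_⟩⟩
  · rw [hsrc]
    exact ⟨hΨ.contDiffAt.mem_toOpenPartialHomeomorph_source _ _, hxV, hx₀⟩
  · exact (Φ.contDiffAt_symm hy (hderiv _ (hsub (Φ.map_target hy)))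
      hΨ.contDiffAt).contDiffWithinAt
  · have h1 : ContDiff ℝ ∞ (wirt f) := by
      have h2 (v : Plane) : ContDiff ℝ ∞ fun x => fderiv ℝ f x v :=
        (hf.fderiv_right (m := ∞) (by simp)).clm_apply contDiff_const
      exact ((h2 _).sub (contDiff_const.mul (h2 _))).div_const _
    have h3 : ContDiff ℝ ∞ fun x => Complex.normSq (wirt f x) := by
      simp only [Complex.normSq_apply]
      have h4 := Complex.reCLM.contDiff.comp h1
      have h5 := Complex.imCLM.contDiff.comp h1
      exact (h4.mul h4).add (h5.mul h5)
    exact (contDiff_const.mul h3).contDiffOn.div (hN.mono fun x hx => (hsub hx).2)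
      fun x hx => (hN0 x (hsub hx).2).ne'
  · exact div_pos (mul_pos (by norm_num) (Complex.normSq_pos.2 (hf0 x))) (hN0 x (hsub hx).2)
  · have hxU := (hsub hx).2
    exact inner_fderiv_of_beltrami (g := fun i j => g i j x) (hfd x) (hs x hxU) (hE x hxU)
      (hd x hxU) (hVμ (hsub hx).1) i j

end Flat

end RiemSurf

end

/-! ### Isothermal charts on an oriented surface. -/

noncomputable section

namespace RiemSurf

open Set Filter Topology

section Isothermal

lemma mem_contDiffGroupoid_of_contDiffOn {Φ : OpenPartialHomeomorph Plane Plane}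
    (h : ContDiffOn ℝ ∞ Φ Φ.source) (h' : ContDiffOn ℝ ∞ Φ.symm Φ.target) :
    Φ ∈ contDiffGroupoid ∞ (𝓡 2) := by
  refine mem_groupoid_of_pregroupoid.2 ⟨?_, ?_⟩
  · simpa [contDiffPregroupoid] using h
  · simpa [contDiffPregroupoid] using h'

variable {M : Type*} [TopologicalSpace M] [ChartedSpace Plane M] [IsManifold (𝓡 2) ∞ M]

lemma trans_mem_maximalAtlas {ψ : OpenPartialHomeomorph M Plane}
    (hψ : ψ ∈ IsManifold.maximalAtlas (𝓡 2) ∞ M) {Φ : OpenPartialHomeomorph Plane Plane}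
    (hΦ : Φ ∈ contDiffGroupoid ∞ (𝓡 2)) : ψ.trans Φ ∈ IsManifold.maximalAtlas (𝓡 2) ∞ M := by
  intro e he
  obtain ⟨h1, h2⟩ := hψ e he
  refine ⟨?_, ?_⟩
  · rw [OpenPartialHomeomorph.trans_symm_eq_symm_trans_symm, OpenPartialHomeomorph.trans_assoc]
    exact StructureGroupoid.trans _ (StructureGroupoid.symm _ hΦ) h1
  · rw [← OpenPartialHomeomorph.trans_assoc]
    exact StructureGroupoid.trans _ h2 hΦ

/-- At a point of non-differentiability `fderiv` is zero by convention, and its determinant on the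
plane is then zero. Positive Jacobians thus license the chain rule by themselves. -/
lemma differentiableAt_of_det_fderiv_pos {F : Plane → Plane} {y : Plane}
    (h : 0 < (fderiv ℝ F y).det) : DifferentiableAt ℝ F y := by
  by_contra hF
  rw [fderiv_zero_of_not_differentiableAt hF, det_plane] at h
  simp at h

lemma OrientedAtlas.isPositive_trans (𝒪 : OrientedAtlas M) {ψ : OpenPartialHomeomorph M Plane}
    (hψ : ψ ∈ 𝒪.charts) {Φ : OpenPartialHomeomorph Plane Plane}
    (hΦ : ∀ y ∈ Φ.target, 0 < (fderiv ℝ Φ.symm y).det) : 𝒪.IsPositive (ψ.trans Φ) := by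
  intro ψ' hψ' y hy
  have hy1 : y ∈ Φ.target := by
    have := hy.1
    simp only [OpenPartialHomeomorph.trans_symm_eq_symm_trans_symm] at this
    exact this.1
  have hy2 : Φ.symm y ∈ (ψ.symm.trans ψ').source := by
    have h1 := hy.1
    simp only [OpenPartialHomeomorph.trans_symm_eq_symm_trans_symm] at h1
    exact ⟨h1.2, hy.2⟩
  have h1 := 𝒪.jacobian_pos ψ hψ ψ' hψ' _ hy2
  have h2 := hΦ y hy1
  have h3 : ⇑((ψ.trans Φ).symm.trans ψ') = ⇑(ψ.symm.trans ψ') ∘ Φ.symm := rfl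
  rw [h3, fderiv_comp y (differentiableAt_of_det_fderiv_pos h1)
    (differentiableAt_of_det_fderiv_pos h2), ContinuousLinearMap.det,
    ContinuousLinearMap.toLinearMap_comp, LinearMap.det_comp]
  exact mul_pos h1 h2

variable [Bundle.RiemannianBundle (fun x : M => TangentSpace (𝓡 2) x)]

/-- The coefficients of the metric in the chart `ψ`. -/
def metricCoef (ψ : OpenPartialHomeomorph M Plane) (i j : Fin 2) (y : Plane) : ℝ :=
  inner ℝ (coordVec ψ i y) (coordVec ψ j y)

lemma metricCoef_comm (ψ : OpenPartialHomeomorph M Plane) (i j : Fin 2) (y : Plane) :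
    metricCoef ψ i j y = metricCoef ψ j i y := real_inner_comm _ _

variable {ψ : OpenPartialHomeomorph M Plane}

lemma inner_mfderiv_chart_symm (ψ : OpenPartialHomeomorph M Plane) (y v w : Plane) :
    inner ℝ (mfderiv (𝓡 2) (𝓡 2) ψ.symm y v) (mfderiv (𝓡 2) (𝓡 2) ψ.symm y w) =
      ∑ i, ∑ j, v i * w j * metricCoef ψ i j y := by
  rw [mfderiv_chart_symm_eq, mfderiv_chart_symm_eq]
  simp only [inner_add_left, inner_add_right, real_inner_smul_left, real_inner_smul_right,
    Fin.sum_univ_two, metricCoef]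
  ring

lemma inner_mfderiv_chart_symm_self_pos (hψ : ψ ∈ IsManifold.maximalAtlas (𝓡 2) ∞ M) {y v : Plane}
    (hy : y ∈ ψ.target) (hv : v ≠ 0) :
    0 < inner ℝ (mfderiv (𝓡 2) (𝓡 2) ψ.symm y v) (mfderiv (𝓡 2) (𝓡 2) ψ.symm y v) := by
  obtain ⟨L, hL⟩ := exists_chartEquiv hψ hy
  erw [hL]
  refine real_inner_self_pos.2 fun h => hv ?_
  exact L.map_eq_zero_iff.1 h

lemma metricCoef_zero_zero_pos (hψ : ψ ∈ IsManifold.maximalAtlas (𝓡 2) ∞ M) {y : Plane}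
    (hy : y ∈ ψ.target) : 0 < metricCoef ψ 0 0 y :=
  inner_mfderiv_chart_symm_self_pos hψ hy (by simp)

lemma metricCoef_det_pos (hψ : ψ ∈ IsManifold.maximalAtlas (𝓡 2) ∞ M) {y : Plane}
    (hy : y ∈ ψ.target) :
    0 < metricCoef ψ 0 0 y * metricCoef ψ 1 1 y - metricCoef ψ 0 1 y ^ 2 := by
  have h0 := metricCoef_zero_zero_pos hψ hy
  -- The vector `(-F, E)` has squared length `E (EG - F²)`.
  have h1 := inner_mfderiv_chart_symm_self_pos hψ hy (v := !₂[-metricCoef ψ 0 1 y, metricCoef ψ 0 0 y])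
    (fun h => h0.ne' (by simpa using congrArg (fun v : Plane => v 1) h))
  rw [inner_mfderiv_chart_symm] at h1
  simp only [Fin.sum_univ_two, metricCoef_comm ψ 1 0] at h1
  refine pos_of_mul_pos_right (a := metricCoef ψ 0 0 y) ?_ h0.le
  refine h1.trans_eq ?_
  simp
  ring

variable [IsContMDiffRiemannianBundle (𝓡 2) ∞ Plane (fun x : M => TangentSpace (𝓡 2) x)]

lemma contDiffOn_metricCoef (hψ : ψ ∈ IsManifold.maximalAtlas (𝓡 2) ∞ M) (i j : Fin 2) :
    ContDiffOn ℝ ∞ (metricCoef ψ i j) ψ.target := by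
  intro y hy
  have h1 := (contMDiffAt_coordField hψ (ψ.map_target hy) (unitVec i)).inner_bundle
    (contMDiffAt_coordField hψ (ψ.map_target hy) (unitVec j))
  have h2 := (ContMDiffAt.comp (I' := 𝓡 2) y h1 (contMDiffAt_chart_symm hψ hy)).contDiffAt
  refine (h2.congr_of_eventuallyEq ?_).contDiffWithinAt
  filter_upwards [ψ.open_target.mem_nhds hy] with z hz
  have h3 (k : Fin 2) : coordVec ψ k z = coordField ψ (unitVec k) (ψ.symm z) :=
    ((localRep_eq_iff hψ hz _ _).1 (localRep_coordField hψ hz (unitVec k))).symm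
  rw [metricCoef, h3, h3]
  rfl

/-- A chart of the oriented atlas is followed by an orientation-preserving map of the plane that
makes its metric coefficients conformally flat. -/
theorem exists_isothermal_chart (𝒪 : OrientedAtlas M) (p : M) :
    ∃ φ : OpenPartialHomeomorph M Plane, IsIsothermal φ ∧ 𝒪.IsPositive φ ∧ p ∈ φ.source := by
  obtain ⟨ψ, hψ𝒪, hp⟩ := 𝒪.cover p
  have hψ := 𝒪.smooth hψ𝒪
  obtain ⟨Φ, hpΦ, hΦψ, hΦ, hΦs, hdet, l, hl, hconf⟩ := exists_conformal_diffeo ψ.open_target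
    (contDiffOn_metricCoef hψ) (fun x _ => metricCoef_comm ψ 1 0 x)
    (fun x hx => metricCoef_zero_zero_pos hψ hx) (fun x hx => metricCoef_det_pos hψ hx)
    (ψ.map_source hp)
  have hinv (y : Plane) (hy : y ∈ Φ.target) (v : Plane) :
      fderiv ℝ Φ (Φ.symm y) (fderiv ℝ Φ.symm y v) = v := by
    have hy' := Φ.map_target hy
    have h1 := ((hΦ.contDiffAt (Φ.open_source.mem_nhds hy')).differentiableAt
      (by simp)).hasFDerivAt.comp y
      ((hΦs.contDiffAt (Φ.open_target.mem_nhds hy)).differentiableAt (by simp)).hasFDerivAt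
    have h2 : Φ ∘ Φ.symm =ᶠ[𝓝 y] id := by
      filter_upwards [Φ.open_target.mem_nhds hy] with z hz
      exact Φ.right_inv hz
    exact congrArg (fun L : Plane →L[ℝ] Plane => L v)
      (h1.unique ((hasFDerivAt_id y).congr_of_eventuallyEq h2))
  have hsub {y : Plane} (hy : y ∈ (ψ.trans Φ).target) : y ∈ Φ.target := by
    rw [OpenPartialHomeomorph.trans_target] at hy
    exact hy.1
  -- The flat metric pulls back to `l g`, so in the new coordinates `g` is `l⁻¹` times the flat
  -- metric and `e^{2ρ} = l⁻¹`.
  refine ⟨ψ.trans Φ, ⟨trans_mem_maximalAtlas hψ (mem_contDiffGroupoid_of_contDiffOn hΦ hΦs),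
    fun y => -Real.log (l (Φ.symm y)) / 2, ?_, fun y hy i j => ?_⟩,
    𝒪.isPositive_trans hψ𝒪 fun y hy => ?_, ?_⟩
  · refine (ContDiffOn.log ?_ fun y hy => ?_).neg.div_const _
    · exact (hl.comp hΦs fun y hy => Φ.map_target hy).mono fun y hy => hsub hy
    · exact (hconf _ (Φ.map_target (hsub hy))).1.ne'
  · have hyΦ := hsub hy
    have hx := Φ.map_target hyΦ
    obtain ⟨hl0, hij⟩ := hconf _ hx
    have hcoord (k : Fin 2) : coordVec (ψ.trans Φ) k y =
        mfderiv (𝓡 2) (𝓡 2) ψ.symm (Φ.symm y) (fderiv ℝ Φ.symm y (unitVec k)) := by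
      have h1 : MDifferentiableAt (𝓡 2) (𝓡 2) Φ.symm y :=
        ((hΦs.contDiffAt (Φ.open_target.mem_nhds hyΦ)).differentiableAt
          (by simp)).mdifferentiableAt
      have h2 : MDifferentiableAt (𝓡 2) (𝓡 2) ψ.symm (Φ.symm y) :=
        (contMDiffAt_chart_symm hψ (hΦψ hx)).mdifferentiableAt (by simp)
      have h3 := mfderiv_comp y h2 h1
      rw [mfderiv_eq_fderiv] at h3
      exact congrArg (fun L => L (unitVec k)) h3
    have key : inner ℝ (coordVec (ψ.trans Φ) i y) (coordVec (ψ.trans Φ) j y) =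
        ∑ a, ∑ b, fderiv ℝ Φ.symm y (unitVec i) a * fderiv ℝ Φ.symm y (unitVec j) b *
          metricCoef ψ a b (Φ.symm y) := by
      rw [hcoord, hcoord]
      exact inner_mfderiv_chart_symm ψ (Φ.symm y) _ _
    have hflat (v w : Plane) : inner ℝ (fderiv ℝ Φ (Φ.symm y) v) (fderiv ℝ Φ (Φ.symm y) w) =
        l (Φ.symm y) * ∑ a, ∑ b, v a * w b * metricCoef ψ a b (Φ.symm y) := by
      conv_lhs => rw [plane_eq_sum v, plane_eq_sum w]
      simp only [map_add, map_smul, inner_add_left, inner_add_right, real_inner_smul_left,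
        real_inner_smul_right, hij, Fin.sum_univ_two]
      ring
    have h4 := hflat (fderiv ℝ Φ.symm y (unitVec i)) (fderiv ℝ Φ.symm y (unitVec j))
    rw [hinv y hyΦ, hinv y hyΦ, ← key] at h4
    have h5 : Real.exp (2 * (-Real.log (l (Φ.symm y)) / 2)) = (l (Φ.symm y))⁻¹ := by
      rw [mul_div_cancel₀ _ two_ne_zero, Real.exp_neg, Real.exp_log hl0]
    have h6 : inner ℝ (unitVec i) (unitVec j) = if i = j then (1 : ℝ) else 0 := by
      simp [EuclideanSpace.inner_single_left]
    rw [h6] at h4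
    rw [h5, ← mul_right_inj' hl0.ne', ← h4]
    split_ifs
    · rw [mul_inv_cancel₀ hl0.ne']
    · rw [mul_zero]
  · have h1 : (fderiv ℝ Φ (Φ.symm y)).det * (fderiv ℝ Φ.symm y).det = 1 := by
      have h2 : (fderiv ℝ Φ (Φ.symm y) : Plane →ₗ[ℝ] Plane) ∘ₗ (fderiv ℝ Φ.symm y) =
          LinearMap.id := LinearMap.ext (hinv y hy)
      have h3 := congrArg LinearMap.det h2
      rwa [LinearMap.det_comp, LinearMap.det_id] at h3
    exact pos_of_mul_pos_right (h1 ▸ one_pos) (hdet _ (Φ.map_target hy)).le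
  · rw [OpenPartialHomeomorph.trans_source]
    exact ⟨hp, hpΦ⟩

end Isothermal

end RiemSurf

end

/-! ### The conditions on the surface in terms of isothermal charts. -/

noncomputable section

namespace RiemSurf

open Set Filter Topology

section Conditions

variable {M : Type*} [TopologicalSpace M] [ChartedSpace Plane M] [IsManifold (𝓡 2) ∞ M]

/-- Vectors extend to globally smooth vector fields. -/
lemma exists_smoothField [T2Space M] {φ : OpenPartialHomeomorph M Plane}
    (hφ : φ ∈ IsManifold.maximalAtlas (𝓡 2) ∞ M) {y : Plane} (hy : y ∈ φ.target) (v : Plane) :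
    ∃ X : Π x : M, TangentSpace (𝓡 2) x, IsSmoothField X ∧ localRep φ X y = v := by
  have hx := φ.map_target hy
  obtain ⟨f, -, hf⟩ := (SmoothBumpFunction.nhds_basis_tsupport (I := 𝓡 2)
    (φ.symm y)).mem_iff.1 (φ.open_source.mem_nhds hx)
  refine ⟨fun x => f x • coordField φ v x, fun x => ?_, ?_⟩
  · by_cases h : x ∈ tsupport f
    · exact ContMDiffAt.smul_section (f.contMDiff x) (contMDiffAt_coordField hφ (hf h) v)
    · have h0 : (fun x => (⟨x, f x • coordField φ v x⟩ : TangentBundle (𝓡 2) M)) =ᶠ[𝓝 x]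
          fun x => ⟨x, 0⟩ := by
        filter_upwards [notMem_tsupport_iff_eventuallyEq.1 h] with z hz
        simp [hz]
      exact (Bundle.contMDiff_zeroSection ℝ (fun x : M => TangentSpace (𝓡 2) x)
        |>.contMDiffAt).congr_of_eventuallyEq h0
  · rw [localRep_eq_iff hφ hy, f.eq_one, one_smul,
      ← mfderiv_chart_symm_localRep hφ hy (coordField φ v), localRep_coordField hφ hy]

variable {T : Π x : M, TangentSpace (𝓡 2) x →L[ℝ] TangentSpace (𝓡 2) x}
  [Bundle.RiemannianBundle (fun x : M => TangentSpace (𝓡 2) x)]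
  [IsContMDiffRiemannianBundle (𝓡 2) ∞ Plane (fun x : M => TangentSpace (𝓡 2) x)]

/-- A condition on matrix fields holds at all points of all isothermal charts. -/
def HoldsInIsothermal (T : Π x : M, TangentSpace (𝓡 2) x →L[ℝ] TangentSpace (𝓡 2) x)
    (C : OpenPartialHomeomorph M Plane → Prop)
    (P : (Plane → ℝ) → (Plane → Plane →L[ℝ] Plane) → Plane → Prop) : Prop :=
  ∀ (φ : OpenPartialHomeomorph M Plane) (ρ : Plane → ℝ),
    φ ∈ IsManifold.maximalAtlas (𝓡 2) ∞ M → ContDiffOn ℝ ∞ ρ φ.target → HasConformalFactor φ ρ →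
    C φ → ∀ y ∈ φ.target, P ρ (tensorRep φ T) y

/-- The family of charts `C` contains isothermal charts around every point. -/
def IsothermalCover (C : OpenPartialHomeomorph M Plane → Prop) : Prop :=
  ∀ p : M, ∃ φ : OpenPartialHomeomorph M Plane, IsIsothermal φ ∧ C φ ∧ p ∈ φ.source

variable {C : OpenPartialHomeomorph M Plane → Prop}

lemma IsothermalCover.exists_chart (hC : IsothermalCover C) (p : M) :
    ∃ (φ : OpenPartialHomeomorph M Plane) (ρ : Plane → ℝ),
      φ ∈ IsManifold.maximalAtlas (𝓡 2) ∞ M ∧ ContDiffOn ℝ ∞ ρ φ.target ∧ HasConformalFactor φ ρ ∧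
      C φ ∧ ∃ y ∈ φ.target, φ.symm y = p := by
  obtain ⟨φ, ⟨hφ, ρ, hρd, hρ⟩, hCφ, hp⟩ := hC p
  exact ⟨φ, ρ, hφ, hρd, hρ, hCφ, φ p, φ.map_source hp, φ.left_inv hp⟩

lemma isDivFree_iff (hC : IsothermalCover C) (hT : IsSmoothTensor T) (hs : IsSymmetricTensor T) :
    IsDivFree T ↔ HoldsInIsothermal T C DivEq := by
  constructor
  · intro h φ ρ hφ hρd hρ _ y hy
    exact (hρ.divTensor_eq_zero_iff hφ hρd hT hs hy).1 (h _)
  · intro h p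
    obtain ⟨φ, ρ, hφ, hρd, hρ, hCφ, y, hy, rfl⟩ := hC.exists_chart p
    exact (hρ.divTensor_eq_zero_iff hφ hρd hT hs hy).2 (h φ ρ hφ hρd hρ hCφ y hy)

/-- The Codazzi condition tests global smooth fields, while the coordinate equations need arbitrary
vectors at a point. Bump functions provide the global extensions, and tensoriality makes their
choice irrelevant. -/
lemma isCodazzi_iff [T2Space M] (hC : IsothermalCover C) (hT : IsSmoothTensor T)
    (hs : IsSymmetricTensor T) : IsCodazzi T ↔ HoldsInIsothermal T C CodazziEq := by
  constructor
  · intro h φ ρ hφ hρd hρ _ y hy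
    rw [← conformalNabla_symm_iff (hT.differentiableAt hφ hy) (hρ.entry_symm_eventually hφ hs hy)]
    intro u v
    obtain ⟨X, hX, rfl⟩ := exists_smoothField hφ hy u
    obtain ⟨Y, hY, rfl⟩ := exists_smoothField hφ hy v
    exact (hρ.nablaTensor_symm_iff hφ hρd hT hy ((hX _).mdifferentiableAt (by simp))
      ((hY _).mdifferentiableAt (by simp))).1 (h X Y hX hY _)
  · intro h X Y hX hY p
    obtain ⟨φ, ρ, hφ, hρd, hρ, hCφ, y, hy, rfl⟩ := hC.exists_chart p
    refine (hρ.nablaTensor_symm_iff hφ hρd hT hy ((hX _).mdifferentiableAt (by simp))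
      ((hY _).mdifferentiableAt (by simp))).2 ?_
    exact (conformalNabla_symm_iff (hT.differentiableAt hφ hy)
      (hρ.entry_symm_eventually hφ hs hy)).2 (h φ ρ hφ hρd hρ hCφ y hy) _ _

lemma isHolomorphicHopf_iff (𝒪 : OrientedAtlas M) (hT : IsSmoothTensor T)
    (hs : IsSymmetricTensor T) :
    IsHolomorphicHopf 𝒪 T ↔ HoldsInIsothermal T 𝒪.IsPositive HopfEq := by
  have hsurj (y : Plane) : ∃ z, toPlane z = y :=
    ⟨Complex.orthonormalBasisOneI.repr.symm y, (toPlane_eq_repr _).trans (LinearIsometryEquiv.apply_symm_apply _ y)⟩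
  constructor
  · intro h φ ρ hφ hρd hρ hpos y hy
    obtain ⟨z, rfl⟩ := hsurj y
    refine (hρ.differentiableAt_hopf_iff hφ hρd hT hs hy).1 ?_
    exact (h φ ⟨hφ, ρ, hρd, hρ⟩ hpos z hy).differentiableAt
      ((hasFDerivAt_toPlane z).continuousAt.preimage_mem_nhds (φ.open_target.mem_nhds hy))
  · rintro h φ ⟨hφ, ρ, hρd, hρ⟩ hpos z hz
    exact ((HasConformalFactor.differentiableAt_hopf_iff hρ hφ hρd hT hs hz).2
      (h φ ρ hφ hρd hρ hpos _ hz)).differentiableWithinAt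

/-- A vanishing differential makes the trace constant on the preimage of a coordinate ball, which is
convex. Connectedness of `M` passes from local to global constancy. -/
lemma hasConstantTrace_iff [ConnectedSpace M] (hC : IsothermalCover C) (hT : IsSmoothTensor T) :
    HasConstantTrace T ↔ HoldsInIsothermal T C fun _ => TraceEq := by
  constructor
  · rintro ⟨c, h⟩ φ ρ hφ hρd hρ _ y hy
    have hA := hT.differentiableAt hφ hy
    have he : (fun y => entry (tensorRep φ T) 0 0 y + entry (tensorRep φ T) 1 1 y) =ᶠ[𝓝 y]
        fun _ => c := by
      filter_upwards [φ.open_target.mem_nhds hy] with z hz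
      rw [← tensorTrace_chart hφ hz, h]
    have h0 := he.fderiv_eq (𝕜 := ℝ)
    rw [fderiv_fun_add (differentiableAt_entry hA 0 0) (differentiableAt_entry hA 1 1),
      fderiv_fun_const] at h0
    exact ⟨congrArg (fun L => L (unitVec 0)) h0, congrArg (fun L => L (unitVec 1)) h0⟩
  · intro h
    have hloc : IsLocallyConstant (tensorTrace T) := by
      refine IsLocallyConstant.iff_eventually_eq _ |>.2 fun p => ?_
      obtain ⟨φ, ρ, hφ, hρd, hρ, hCφ, y, hy, rfl⟩ := hC.exists_chart p
      obtain ⟨ε, hε, hball⟩ := Metric.mem_nhds_iff.1 (φ.open_target.mem_nhds hy)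
      have hd (z : Plane) (hz : z ∈ Metric.ball y ε) : HasFDerivAt
          (fun y => entry (tensorRep φ T) 0 0 y + entry (tensorRep φ T) 1 1 y)
          (0 : Plane →L[ℝ] ℝ) z := by
        have hA := hT.differentiableAt hφ (hball hz)
        have h1 := (differentiableAt_entry hA 0 0).hasFDerivAt.add
          (differentiableAt_entry hA 1 1).hasFDerivAt
        refine h1.congr_fderiv (ContinuousLinearMap.ext fun v => ?_)
        obtain ⟨h2, h3⟩ := h φ ρ hφ hρd hρ hCφ z (hball hz)
        rw [add_apply, fderiv_apply_eq_pd, fderiv_apply_eq_pd]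
        simp only [zero_apply]
        linear_combination v 0 * h2 + v 1 * h3
      have hx := φ.map_target hy
      have hmem : φ.source ∩ φ ⁻¹' Metric.ball y ε ∈ 𝓝 (φ.symm y) :=
        inter_mem (φ.open_source.mem_nhds hx) ((φ.continuousAt hx).preimage_mem_nhds
          (by rw [φ.right_inv hy]; exact Metric.ball_mem_nhds y hε))
      filter_upwards [hmem] with q hq
      have hq' := φ.left_inv hq.1
      rw [← hq', tensorTrace_chart hφ (hball hq.2), tensorTrace_chart hφ hy]
      exact (convex_ball y ε).is_const_of_fderivWithin_eq_zero (𝕜 := ℝ)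
        (f := fun y => entry (tensorRep φ T) 0 0 y + entry (tensorRep φ T) 1 1 y)
        (fun z hz => (hd z hz).differentiableAt.differentiableWithinAt)
        (fun z hz => by
          rw [fderivWithin_of_isOpen Metric.isOpen_ball hz, (hd z hz).fderiv])
        hq.2 (Metric.mem_ball_self hε)
    obtain ⟨p⟩ := (inferInstance : Nonempty M)
    exact ⟨tensorTrace T p, fun x => hloc.apply_eq_of_preconnectedSpace x p⟩

end Conditions

end RiemSurf

end

theorem mainTheorem2 {M : Type*} [TopologicalSpace M] [T2Space M] [ConnectedSpace M]
    [ChartedSpace RiemSurf.Plane M] [IsManifold (𝓡 2) ∞ M]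
    [Bundle.RiemannianBundle (fun x : M => TangentSpace (𝓡 2) x)]
    [IsContMDiffRiemannianBundle (𝓡 2) ∞ RiemSurf.Plane (fun x : M => TangentSpace (𝓡 2) x)]
    (𝒪 : RiemSurf.OrientedAtlas M)
    (T : Π x : M, TangentSpace (𝓡 2) x →L[ℝ] TangentSpace (𝓡 2) x)
    (hT : RiemSurf.IsSmoothTensor T) (hsymm : RiemSurf.IsSymmetricTensor T) :
    (RiemSurf.IsDivFree T ∧ RiemSurf.HasConstantTrace T →
      RiemSurf.IsHolomorphicHopf 𝒪 T ∧ RiemSurf.IsCodazzi T) ∧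
    (RiemSurf.IsDivFree T ∧ RiemSurf.IsHolomorphicHopf 𝒪 T →
      RiemSurf.HasConstantTrace T ∧ RiemSurf.IsCodazzi T) ∧
    (RiemSurf.IsDivFree T ∧ RiemSurf.IsCodazzi T →
      RiemSurf.HasConstantTrace T ∧ RiemSurf.IsHolomorphicHopf 𝒪 T) ∧
    (RiemSurf.HasConstantTrace T ∧ RiemSurf.IsHolomorphicHopf 𝒪 T →
      RiemSurf.IsDivFree T ∧ RiemSurf.IsCodazzi T) ∧
    (RiemSurf.HasConstantTrace T ∧ RiemSurf.IsCodazzi T →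
      RiemSurf.IsDivFree T ∧ RiemSurf.IsHolomorphicHopf 𝒪 T) ∧
    (RiemSurf.IsHolomorphicHopf 𝒪 T ∧ RiemSurf.IsCodazzi T →
      RiemSurf.IsDivFree T ∧ RiemSurf.HasConstantTrace T) := by
  -- Holomorphy concerns positive charts only, so all four conditions are tested on these. Since
  -- they cover the surface, nothing is lost for the other three, and the pointwise linear algebra
  -- concludes.
  have hC : RiemSurf.IsothermalCover 𝒪.IsPositive := RiemSurf.exists_isothermal_chart 𝒪
  rw [RiemSurf.isDivFree_iff hC hT hsymm, RiemSurf.isCodazzi_iff hC hT hsymm,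
    RiemSurf.isHolomorphicHopf_iff 𝒪 hT hsymm, RiemSurf.hasConstantTrace_iff hC hT]
  refine ⟨?_, ?_, ?_, ?_, ?_, ?_⟩ <;> rintro ⟨h1, h2⟩ <;>
    refine ⟨fun φ ρ hφ hρd hρ hp y hy => ?_, fun φ ρ hφ hρd hρ hp y hy => ?_⟩ <;>
    replace h1 := h1 φ ρ hφ hρd hρ hp y hy <;> replace h2 := h2 φ ρ hφ hρd hρ hp y hy
  · exact h1.hopf_iff_trace.2 h2
  · exact h1.codazzi_iff_trace.2 h2
  · exact h1.hopf_iff_trace.1 h2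
  · exact h1.codazzi_iff_trace.2 (h1.hopf_iff_trace.1 h2)
  · exact h1.codazzi_iff_trace.1 h2
  · exact h1.hopf_iff_trace.2 (h1.codazzi_iff_trace.1 h2)
  · exact h1.hopf_iff_div.1 h2
  · exact h1.codazzi_iff_div.2 (h1.hopf_iff_div.1 h2)
  · exact h1.codazzi_iff_div.1 h2
  · exact h1.hopf_iff_div.2 (h1.codazzi_iff_div.1 h2)
  · exact (h1.trace_of_codazzi h2).hopf_iff_div.1 h1
  · exact h1.trace_of_codazzi h2
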